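/- Let $\langle v,w\rangle=v^1w^1+v^2w^2-v^3w^3$ be the Minkowski form on $\mathbb{R}^3$, let $v\times_m w=(v^3w^2-v^2w^3,\;v^1w^3-v^3w^1,\;v^1w^2-v^2w^1)$, and let $\mathbb{H}=\{y\in\mathbb{R}^3:\langle y,y\rangle=-1,\ y^3>0\}$ be the hyperbolic plane with the induced metric $g_0$, oriented so that the rotation by $\pi/2$ in $T_y\mathbb{H}$ is $J(y)v=y\times_m v$. Let $SO(2,1)_+$ be the group of linear maps of determinant $1$ that preserve $\langle\cdot,\cdot\rangle$ and map $\mathbb{H}$ into itself. Let $\Gamma\subset SO(2,1)_+$ be a subgroup acting freely and properly discontinuously on $\mathbb{H}$ with compact quotient $M=\mathbb{H}/\Gamma$, let $\pi_M:\mathbb{H}\to M$ be the projection, and give $M$ the induced metric and orientation. Put $S^1=\mathbb{R}/\mathbb{Z}$, and let $B$ be the open unit disc in $\mathbb{R}^2$, with $\partial B$ parametrized by $t\mapsto e^{2\pi i t}$, $t\in S^1$. For $N=\mathbb{H}$ or $N=M$ and a constant $k_0>0$ consider, for $\gamma\in H^{2,2}(S^1,N)$, the equation $$D_t\dot\gamma=|\dot\gamma|\,k_0\,J(\gamma)\dot\gamma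 .\qquad(\ast)$$ A $C^1$ immersion $\gamma:\partial B\to N$ is called oriented Alexandrov embedded if there is a $C^1$ immersion $F:\overline B\to N$ with $F|_{\partial B}=\gamma$ that is orientation preserving in the sense that $\langle DF|_x x,\ J(\gamma(x))\dot\gamma(x)\rangle<0$ for all $x\in\partial B$, i.e. $J(\gamma)\dot\gamma$ points to the side of the inner normal of the disc. A positive orthonormal frame is a triple $(v_0,v_1,w)$ of pairwise $\langle\cdot,\cdot\rangle$-orthogonal vectors of $\mathbb{R}^3$ with $\langle v_0,v_0\rangle=\langle v_1,v_1\rangle=1$, $\langle w,w\rangle=-1$, $v_0\times_m v_1=w$ and $w\in\mathbb{H}$. For $r,\lambda>0$ let $$\alpha(t,\lambda,v_0,v_1,w)=\sqrt{1+r^2}\,w+r\cos(\lambda r^{-1}t)\,v_1+r\sin(\lambda r^{-1}t)\,v_0\in\mathbb{H}.$$ For every $k_0>1$ there is a unique $r=r(k_0)>0$ with $k_0=\sqrt{1+r^2}/r$. With this $r$ the following hold. (0) The set of positive orthonormal frames is a nonempty smooth embedded three-dimensional submanifold of $(\mathbb{R}^3)^3$. (1) For every $k_0>1$, the oriented Alexandrov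 embedded solutions of $(\ast)$ in $H^{2,2}(S^1,\mathbb{H})$ are exactly the curves $\alpha(\cdot,2\pi r,v_0,v_1,w)$ with $(v_0,v_1,w)$ a positive orthonormal frame. These curves are simple, and the map $(v_0,v_1,w)\mapsto\alpha(\cdot,2\pi r,v_0,v_1,w)$, which is defined by the same formula and linear on $(\mathbb{R}^3)^3$, is injective. For every integer $n\ge1$ and every frame, $\alpha(\cdot,2\pi nr,v_0,v_1,w)$ is a solution of $(\ast)$, and it is oriented Alexandrov embedded if and only if $n=1$. (2) There is a constant $C_{k_0}=C_{k_0}(\Gamma)>1$ such that for every $k_0\ge C_{k_0}$ the oriented Alexandrov embedded solutions of $(\ast)$ in $H^{2,2}(S^1,M)$ are exactly the curves $\pi_M\circ\alpha(\cdot,2\pi r,v_0,v_1,w)$ with $(v_0,v_1,w)$ a positive orthonormal frame. These curves are simple, and two frames give the same curve if and only if they differ by an element of $\Gamma$. For every integer $n\ge1$ and every frame, $\pi_M\circ\alpha(\cdot,2\pi nr,v_0,v_1,w)$ is a solution of $(\ast)$, and it is oriented Alexandrov embedded if and only if $n=1$. -/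

import Mathlib

open Set Function MeasureTheory Matrix
open scoped Topology ContDiff

noncomputable section

namespace MagneticHyp

/-! ### The hyperboloid model -/

/-- The ambient space `ℝ³`, with coordinates `(ξ¹, ξ², τ)`. -/
abbrev V : Type := Fin 3 → ℝ

/-- The Minkowski form `(dξ¹)² + (dξ²)² - (dτ)²`. -/
def mink (v w : V) : ℝ := v 0 * w 0 + v 1 * w 1 - v 2 * w 2

/-- The Minkowski norm (used for spacelike vectors only). -/
def mnorm (v : V) : ℝ := Real.sqrt (mink v v)

/-- The twisted cross product of Minkowski space. -/
def mcross (v w : V) : V :=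
  ![v 2 * w 1 - v 1 * w 2, v 0 * w 2 - v 2 * w 0, v 0 * w 1 - v 1 * w 0]

/-- The upper sheet of the hyperboloid. -/
def hyp : Set V := {y | mink y y = -1 ∧ 0 < y 2}

/-- The hyperbolic plane `ℍ`. Its Riemannian metric is the restriction of `mink` to the tangent
planes `y^⊥`, and its orientation is the one for which the rotation by `π / 2` in the tangent plane
at `y` is `v ↦ mcross y v`. -/
abbrev Hyp : Type := hyp

theorem mink_add_left (u v w : V) : mink (u + v) w = mink u w + mink v w := by
  simp only [mink, Pi.add_apply]; ring

theorem mink_smul_left (a : ℝ) (v w : V) : mink (a • v) w = a * mink v w := by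
  simp only [mink, Pi.smul_apply, smul_eq_mul]; ring

theorem mink_comm (v w : V) : mink v w = mink w v := by
  simp only [mink]; ring

theorem mem_hyp_of_mink_neg {y w : V} (hw : w ∈ hyp) (hy : mink y y = -1) (h : mink y w < 0) :
    y ∈ hyp := by
  obtain ⟨hw1, hw2⟩ := hw
  refine ⟨hy, ?_⟩
  simp only [mink] at hw1 hy h
  by_contra hneg
  have h2 : y 2 ≤ 0 := not_lt.mp hneg
  have hlt : 0 ≤ -(y 2) * w 2 := mul_nonneg (by linarith) hw2.le
  have hlt2 : -(y 2) * w 2 < -(y 0 * w 0 + y 1 * w 1) := by linarith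
  have hsq : (-(y 2) * w 2) ^ 2 < (-(y 0 * w 0 + y 1 * w 1)) ^ 2 :=
    pow_lt_pow_left₀ hlt2 hlt (by norm_num)
  have hy2 : y 2 ^ 2 = 1 + (y 0 ^ 2 + y 1 ^ 2) := by linarith [hy]
  have hw2' : w 2 ^ 2 = 1 + (w 0 ^ 2 + w 1 ^ 2) := by linarith [hw1]
  have e : (-(y 2) * w 2) ^ 2 = (1 + (y 0 ^ 2 + y 1 ^ 2)) * (1 + (w 0 ^ 2 + w 1 ^ 2)) := by
    rw [← hy2, ← hw2']; ring
  rw [e] at hsq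
  nlinarith [sq_nonneg (y 0 * w 1 - y 1 * w 0), sq_nonneg (y 0), sq_nonneg (y 1),
    sq_nonneg (w 0), sq_nonneg (w 1)]

/-! ### Oriented isometries and quotients -/

/-- `SO(2,1)₊`: the linear maps of determinant one that preserve the Minkowski form and map `ℍ`
into itself. -/
def SO21plus : Subgroup (Matrix.SpecialLinearGroup (Fin 3) ℝ) where
  carrier := {A | (∀ v w : V, mink (A.1 *ᵥ v) (A.1 *ᵥ w) = mink v w) ∧
    ∀ y ∈ hyp, A.1 *ᵥ y ∈ hyp}
  one_mem' := by simp
  mul_mem' := by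
    rintro A B ⟨hA, hA'⟩ ⟨hB, hB'⟩
    refine ⟨fun v w => ?_, fun y hy => ?_⟩
    · simp only [Matrix.SpecialLinearGroup.coe_mul, ← Matrix.mulVec_mulVec, hA, hB]
    · simp only [Matrix.SpecialLinearGroup.coe_mul, ← Matrix.mulVec_mulVec]
      exact hA' _ (hB' _ hy)
  inv_mem' := by
    rintro A ⟨hA, hA'⟩
    have key : ∀ v : V, A.1 *ᵥ ((A⁻¹).1 *ᵥ v) = v := fun v => by
      rw [Matrix.mulVec_mulVec, ← Matrix.SpecialLinearGroup.coe_mul, mul_inv_cancel]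
      simp
    have hinv : ∀ v w : V, mink ((A⁻¹).1 *ᵥ v) ((A⁻¹).1 *ᵥ w) = mink v w := fun v w => by
      rw [← hA, key, key]
    refine ⟨hinv, fun y hy => ?_⟩
    have h1 : mink ((A⁻¹).1 *ᵥ y) ((A⁻¹).1 *ᵥ y) = -1 := by rw [hinv]; exact hy.1
    refine ⟨h1, ?_⟩
    by_contra hneg
    have h0 : ((A⁻¹).1 *ᵥ y) 2 ≠ 0 := by
      intro h0
      simp only [mink] at h1
      rw [h0] at h1
      nlinarith [sq_nonneg (((A⁻¹).1 *ᵥ y) 0), sq_nonneg (((A⁻¹).1 *ᵥ y) 1)]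
    have hlt : ((A⁻¹).1 *ᵥ y) 2 < 0 := lt_of_le_of_ne (not_lt.mp hneg) h0
    have hm : -((A⁻¹).1 *ᵥ y) ∈ hyp := by
      refine ⟨?_, by simpa using hlt⟩
      rw [← h1]; simp only [mink, Pi.neg_apply]; ring
    have h2 := (hA' _ hm).2
    rw [Matrix.mulVec_neg, key] at h2
    have h3 := hy.2
    simp only [Pi.neg_apply] at h2
    linarith

/-- The action of `SO(2,1)₊` on `ℍ`. -/
instance instMulActionHyp : MulAction SO21plus Hyp where
  smul A y := ⟨A.1.1 *ᵥ y.1, A.2.2 _ y.2⟩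
  one_smul y := Subtype.ext (by
    change ((1 : SO21plus).1.1) *ᵥ y.1 = y.1
    simp)
  mul_smul A B y := Subtype.ext (by
    change ((A * B).1.1) *ᵥ y.1 = A.1.1 *ᵥ (B.1.1 *ᵥ y.1)
    simp [Matrix.mulVec_mulVec])

/-- The quotient `ℍ / Γ`, with the quotient topology. If `Γ` acts freely and properly
discontinuously, then the local inverses of the projection `ℍ → ℍ / Γ` are the charts of a smooth
structure, and the metric and the orientation of `ℍ` descend to `ℍ / Γ`. Since the projection is
then a local oriented isometry, all differential notions for maps into `ℍ / Γ` are
defined below through these charts, that is through local lifts to `ℍ`. -/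
abbrev QuotHyp (Γ : Subgroup SO21plus) : Type := MulAction.orbitRel.Quotient Γ Hyp

/-- The projection `π : ℍ → ℍ / Γ`. -/
def proj (Γ : Subgroup SO21plus) (y : Hyp) : QuotHyp Γ :=
  Quotient.mk (MulAction.orbitRel Γ Hyp) y

/-! ### Sobolev curves and the equation of constant geodesic curvature -/

/-- `γ` is of class `H^{2,2}` on the bounded open interval `(a, b)`: it is differentiable there, and
its derivative is absolutely continuous with derivative in `L²`. -/
structure IsH22On (γ : ℝ → V) (a b : ℝ) : Prop where
  differentiableAt : ∀ t ∈ Ioo a b, DifferentiableAt ℝ γ t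
  memLp : MemLp (deriv (deriv γ)) 2 (volume.restrict (Ioo a b))
  deriv_sub_deriv : ∀ s ∈ Ioo a b, ∀ t ∈ Ioo a b,
    deriv γ t - deriv γ s = ∫ u in s..t, deriv (deriv γ) u

/-- The covariant derivative `D_t γ̇` along a curve in `ℍ`: the Minkowski-orthogonal projection
of `γ̈` to the tangent plane `γ^⊥`. -/
def covAcc (γ : ℝ → V) (t : ℝ) : V :=
  deriv (deriv γ) t + mink (deriv (deriv γ) t) (γ t) • γ t

/-- The equation `D_t γ̇ = |γ̇| k₀ J(γ) γ̇` almost everywhere on `(a, b)`. -/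
def SolvesOn (k₀ : ℝ) (γ : ℝ → V) (a b : ℝ) : Prop :=
  ∀ᵐ t ∂(volume.restrict (Ioo a b)),
    covAcc γ t = (mnorm (deriv γ t) * k₀) • mcross (γ t) (deriv γ t)

/-- `γ ∈ H^{2,2}(S¹, ℍ)`, with `S¹ = ℝ / ℤ`, solves `D_t γ̇ = |γ̇| k₀ J(γ) γ̇`. -/
def IsSolHyp (k₀ : ℝ) (γ : ℝ → Hyp) : Prop :=
  Periodic γ 1 ∧ ∀ a b : ℝ,
    IsH22On (fun t => (γ t : V)) a b ∧ SolvesOn k₀ (fun t => (γ t : V)) a b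

/-- `c ∈ H^{2,2}(S¹, ℍ / Γ)`, with `S¹ = ℝ / ℤ`, solves `D_t ċ = |ċ| k₀ J(c) ċ`. -/
def IsSolQuot (Γ : Subgroup SO21plus) (k₀ : ℝ) (c : ℝ → QuotHyp Γ) : Prop :=
  Periodic c 1 ∧ ∀ t₀ : ℝ, ∃ a b : ℝ, t₀ ∈ Ioo a b ∧ ∃ γ : ℝ → Hyp,
    (∀ t ∈ Ioo a b, proj Γ (γ t) = c t) ∧
    IsH22On (fun t => (γ t : V)) a b ∧ SolvesOn k₀ (fun t => (γ t : V)) a b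

/-! ### Oriented Alexandrov embedded curves -/

/-- The closed unit disc. -/
def disc : Set ℂ := Metric.closedBall 0 1

/-- The counterclockwise parametrization `t ↦ e^{2πit}` of the unit circle by `ℝ / ℤ`. -/
def circ (t : ℝ) : ℂ := Complex.exp (2 * Real.pi * t * Complex.I)

/-- `F` is a `C¹` immersion on the part of the closed disc in the open set `U`. -/
def ImmersedDiscOn (F : ℂ → V) (U : Set ℂ) : Prop :=
  ContDiffOn ℝ 1 F (disc ∩ U) ∧ ∀ x ∈ disc ∩ U, Injective (fderivWithin ℝ F disc x)

/-- `γ` is a `C¹` immersion on the open interval `(a, b)`. -/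
def ImmersedCurveOn (γ : ℝ → V) (a b : ℝ) : Prop :=
  ContDiffOn ℝ 1 γ (Ioo a b) ∧ ∀ t ∈ Ioo a b, deriv γ t ≠ 0

/-- The disc map `F` is orientation preserving at the boundary point `circ t`: the image of the
outer normal of the disc has negative inner product with `J(γ) γ̇`, where `γ = F ∘ circ`. -/
def OrientedAt (F : ℂ → V) (t : ℝ) : Prop :=
  mink (fderivWithin ℝ F disc (circ t) (circ t))
    (mcross (F (circ t)) (deriv (fun s => F (circ s)) t)) < 0

/-- Oriented Alexandrov embedded curves in `ℍ`. -/
def IsAlexHyp (γ : ℝ → Hyp) : Prop :=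
  (∀ a b : ℝ, ImmersedCurveOn (fun t => (γ t : V)) a b) ∧
  ∃ F : ℂ → Hyp, (∀ t, F (circ t) = γ t) ∧
    ImmersedDiscOn (fun z => (F z : V)) univ ∧
    ∀ t, OrientedAt (fun z => (F z : V)) t

/-- Oriented Alexandrov embedded curves in `ℍ / Γ`. -/
def IsAlexQuot (Γ : Subgroup SO21plus) (c : ℝ → QuotHyp Γ) : Prop :=
  (∀ t₀ : ℝ, ∃ a b : ℝ, t₀ ∈ Ioo a b ∧ ∃ γ : ℝ → Hyp,
    (∀ t ∈ Ioo a b, proj Γ (γ t) = c t) ∧ ImmersedCurveOn (fun t => (γ t : V)) a b) ∧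
  ∃ F : ℂ → QuotHyp Γ, (∀ t, F (circ t) = c t) ∧
    ∀ x ∈ disc, ∃ U : Set ℂ, IsOpen U ∧ x ∈ U ∧ ∃ G : ℂ → Hyp,
      (∀ z ∈ disc ∩ U, proj Γ (G z) = F z) ∧
      ImmersedDiscOn (fun z => (G z : V)) U ∧
      ∀ t, circ t ∈ U → OrientedAt (fun z => (G z : V)) t

/-! ### The circles -/

/-- Positive orthonormal systems `(v₀, v₁, w)` of Minkowski space, with `w` in `ℍ`. -/
def posFrames : Set (V × V × V) :=
  {f | mink f.1 f.2.1 = 0 ∧ mink f.1 f.2.2 = 0 ∧ mink f.2.1 f.2.2 = 0 ∧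
    mink f.1 f.1 = 1 ∧ mink f.2.1 f.2.1 = 1 ∧ mink f.2.2 f.2.2 = -1 ∧
    mcross f.1 f.2.1 = f.2.2 ∧ f.2.2 ∈ hyp}

/-- `√(1+r²) w + r cos(λ t / r) v₁ + r sin(λ t / r) v₀`, for `f = (v₀, v₁, w)`. -/
def alphaVec (r lam : ℝ) (f : V × V × V) (t : ℝ) : V :=
  Real.sqrt (1 + r ^ 2) • f.2.2 + (r * Real.cos (lam * r⁻¹ * t)) • f.2.1 +
    (r * Real.sin (lam * r⁻¹ * t)) • f.1

theorem alphaVec_mem (r lam : ℝ) {f : V × V × V} (hf : f ∈ posFrames) (t : ℝ) :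
    alphaVec r lam f t ∈ hyp := by
  obtain ⟨h01, h0w, h1w, h00, h11, hww, -, hw⟩ := hf
  have hs : Real.sqrt (1 + r ^ 2) ^ 2 = 1 + r ^ 2 := Real.sq_sqrt (by positivity)
  have hpos : 0 < Real.sqrt (1 + r ^ 2) := Real.sqrt_pos.mpr (by positivity)
  have hcs := Real.sin_sq_add_cos_sq (lam * r⁻¹ * t)
  have h10 : mink f.2.1 f.1 = 0 := by rw [mink_comm]; exact h01
  have hw0 : mink f.2.2 f.1 = 0 := by rw [mink_comm]; exact h0w
  have hw1 : mink f.2.2 f.2.1 = 0 := by rw [mink_comm]; exact h1w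
  refine mem_hyp_of_mink_neg hw ?_ ?_
  · have e1 : ∀ x : V, mink x (alphaVec r lam f t) = Real.sqrt (1 + r ^ 2) * mink x f.2.2 +
        r * Real.cos (lam * r⁻¹ * t) * mink x f.2.1 +
        r * Real.sin (lam * r⁻¹ * t) * mink x f.1 := fun x => by
      rw [mink_comm, alphaVec, mink_add_left, mink_add_left, mink_smul_left, mink_smul_left,
        mink_smul_left, mink_comm _ x, mink_comm _ x, mink_comm _ x]
    rw [e1, mink_comm _ f.2.2, mink_comm _ f.2.1, mink_comm _ f.1, e1, e1, e1,
      h01, h0w, h1w, h00, h11, hww, h10, hw0, hw1]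
    linear_combination (-1) * hs + r ^ 2 * hcs
  · rw [alphaVec, mink_add_left, mink_add_left, mink_smul_left, mink_smul_left, mink_smul_left,
      hww, h1w, h0w]
    linarith

/-- The circle `α(·, λ, v₀, v₁, w)` as a curve in `ℍ`. -/
def alpha (r lam : ℝ) (f : posFrames) (t : ℝ) : Hyp :=
  ⟨alphaVec r lam f.1 t, alphaVec_mem r lam f.2 t⟩

/-- `r > 0` is the radius that belongs to the curvature `k₀`. -/
def IsRadius (k₀ r : ℝ) : Prop := 0 < r ∧ k₀ = Real.sqrt (1 + r ^ 2) / r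

/-- `S` is a smooth embedded three-dimensional submanifold of `E`: near each of its points it has a
smooth immersive parametrization by an open subset of `ℝ³` that is a homeomorphism onto its
image. -/
def IsSubmanifold3 {E : Type} [NormedAddCommGroup E] [NormedSpace ℝ E] (S : Set E) : Prop :=
  ∀ p ∈ S, ∃ (W : Set E) (U : Set (Fin 3 → ℝ)) (φ : (Fin 3 → ℝ) → E) (ψ : E → (Fin 3 → ℝ)),
    IsOpen W ∧ p ∈ W ∧ IsOpen U ∧ φ '' U = S ∩ W ∧ ContDiffOn ℝ ∞ φ U ∧
    (∀ u ∈ U, Injective (fderiv ℝ φ u)) ∧ ContinuousOn ψ (S ∩ W) ∧ ∀ u ∈ U, ψ (φ u) = u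

end MagneticHyp

end

noncomputable section

namespace MagneticHyp

/-! ### Winding numbers and immersed discs in the plane -/

/-! In `ℍ` the equation is integrable. An immersed solution is first upgraded from `H^{2,2}` to
`C²`: its velocity is continuous, hence so is the acceleration prescribed by the equation
(`solvesAt_of_isH22On`). Its speed `l` is then constant, and so is the vector `k₀ γ + l⁻¹ J(γ)γ̇`,
which is `w / r` for the centre `w` of a circle. Inserting this conserved vector turns the equation
into a harmonic oscillator about `√(1+r²) w`, so `γ` is a circle, and periodicity makes it an
`n`-fold iterate (`exists_eq_alphaVec`).

The disc forces `n = 1`. Pairing with `v₁` and `v₀` and dividing by `r` gives a linear map to `ℂ`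
that is injective on every tangent plane of `ℍ`, because its kernel is the timelike line through
`w`. It carries the disc to an immersed plane disc whose boundary runs `n` times around the unit
circle. The tangential derivative along concentric circles is a homotopy of loops in `ℂ ∖ {0}` from
the image of a circle under an injective linear map (winding number `±1`) to the boundary tangent
(winding number `n`), so `n = 1` (`eq_one_of_immersed_disc`). Conversely, the cap `capVec` is an
oriented disc bounded by the simple circle.

For `M`, the projection is a covering and a disc is simply connected, so the whole immersed disc
lifts to `ℍ`. Its boundary is a closed lift of the curve, and the classification in `ℍ` applies. Two
lifts of the same curve differ by one element of `Γ`, which acts on circles through their frames. A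
large `k₀` serves simplicity: compactness gives a positive minimal displacement of the nontrivial
elements of `Γ` (`exists_displacement`), and a circle of small radius is too small in diameter to
contain two points identified by `Γ`. -/

theorem eq_of_exp_eq_one {X : Type*} [TopologicalSpace X] [PreconnectedSpace X] {φ : X → ℂ}
    (hφ : Continuous φ) (h : ∀ x, Complex.exp (φ x) = 1) (x y : X) : φ x = φ y := by
  -- Both `φ` and the constant `φ y` lift the constant map `1` through the covering `exp`.
  have := Complex.isCoveringMap_exp.eq_of_comp_eq hφ (continuous_const (y := φ y))
    (by ext z; simp [h]) y rfl
  exact congrFun this x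

theorem exists_log_lift {X : Type*} [TopologicalSpace X] [SimplyConnectedSpace X]
    [LocallyPathConnectedSpace X] {h : X → ℂ} (hc : Continuous h) (h0 : ∀ x, h x ≠ 0) :
    ∃ L : X → ℂ, Continuous L ∧ ∀ x, Complex.exp (L x) = h x := by
  obtain ⟨x₀⟩ : Nonempty X := inferInstance
  obtain ⟨F, ⟨-, hF⟩, -⟩ := Complex.isCoveringMapOn_exp.existsUnique_continuousMap_lifts
    ⟨h, hc⟩ (a₀ := x₀) (e₀ := Complex.log (h x₀)) (by simp [Complex.exp_log (h0 x₀)])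
    (by simpa using h0)
  exact ⟨F, F.continuous, fun x => congrFun hF x⟩

/-- The winding number does not change along a homotopy of loops in `ℂ ∖ {0}`. -/
theorem winding_eq_of_homotopy {H : ℝ × ℝ → ℂ} (hc : Continuous H) (h0 : ∀ p, H p ≠ 0)
    (hper : ∀ ρ t, H (ρ, t + 1) = H (ρ, t)) {ρ₀ ρ₁ : ℝ} {n₀ n₁ : ℤ} {l₀ l₁ : ℝ → ℂ}
    (hl₀ : Continuous l₀) (hl₁ : Continuous l₁) (hp₀ : Periodic l₀ 1) (hp₁ : Periodic l₁ 1)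
    (e₀ : ∀ t, H (ρ₀, t) = Complex.exp (2 * Real.pi * n₀ * t * Complex.I + l₀ t))
    (e₁ : ∀ t, H (ρ₁, t) = Complex.exp (2 * Real.pi * n₁ * t * Complex.I + l₁ t)) :
    n₀ = n₁ := by
  obtain ⟨L, hL, hexp⟩ := exists_log_lift hc h0
  -- The increment of any logarithm over one period is `2πi` times the winding number, since the
  -- periodic part `l` cancels.
  have key : ∀ (ρ : ℝ) (n : ℤ) (l : ℝ → ℂ), Continuous l → Periodic l 1 →
      (∀ t, H (ρ, t) = Complex.exp (2 * Real.pi * n * t * Complex.I + l t)) →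
      L (ρ, 0 + 1) - L (ρ, 0) = 2 * Real.pi * n * Complex.I := by
    intro ρ n l hl hp e
    have := eq_of_exp_eq_one (φ := fun t : ℝ => L (ρ, t) - (2 * Real.pi * n * t * Complex.I + l t))
      (by fun_prop) (fun t => by
        rw [Complex.exp_sub, hexp, e, div_self (Complex.exp_ne_zero _)]) (0 + 1) 0
    have h2 := hp 0
    rw [h2] at this
    push_cast at this
    linear_combination this
  -- This increment is continuous in both variables and lies in `2πiℤ`, so it is the same for `ρ₀`
  -- and `ρ₁`.
  have hshift := eq_of_exp_eq_one (φ := fun p : ℝ × ℝ => L (p.1, p.2 + 1) - L p) (by fun_prop)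
    (fun p => by
      rw [Complex.exp_sub, hexp, hexp, hper, div_self (h0 _)]) (ρ₀, 0) (ρ₁, 0)
  simp only at hshift
  rw [key _ _ _ hl₀ hp₀ e₀, key _ _ _ hl₁ hp₁ e₁] at hshift
  have hpi : (2 * Real.pi * Complex.I : ℂ) ≠ 0 := Complex.two_pi_I_ne_zero
  have : (n₀ : ℂ) = n₁ := mul_left_cancel₀ hpi (by linear_combination hshift)
  exact_mod_cast this

theorem circ_eq (t : ℝ) : circ t = Complex.exp (((2 * Real.pi * t : ℝ) : ℂ) * Complex.I) := by
  simp [circ]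

theorem norm_circ (t : ℝ) : ‖circ t‖ = 1 := by
  rw [circ_eq, Complex.norm_exp_ofReal_mul_I]

theorem circ_periodic : Periodic circ 1 := fun t => by
  have : (2 * Real.pi * ((t + 1 : ℝ) : ℂ) * Complex.I) =
    2 * Real.pi * t * Complex.I + 2 * Real.pi * Complex.I := by push_cast; ring
  rw [circ, this, Complex.exp_periodic, circ]

theorem circ_mem_disc (t : ℝ) : circ t ∈ disc := by simp [disc, norm_circ]

theorem hasDerivAt_circ (t : ℝ) : HasDerivAt circ (2 * Real.pi * (Complex.I * circ t)) t := by
  have h1 : HasDerivAt (fun s : ℝ => 2 * Real.pi * (s : ℂ) * Complex.I)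
      (2 * Real.pi * 1 * Complex.I) t :=
    ((Complex.ofRealCLM.hasDerivAt (x := t)).const_mul _).mul_const _
  refine h1.cexp.congr_deriv ?_
  change _ = 2 * Real.pi * (Complex.I * Complex.exp (2 * Real.pi * t * Complex.I))
  ring

theorem continuous_circ : Continuous circ :=
  continuous_iff_continuousAt.2 fun t => (hasDerivAt_circ t).continuousAt

theorem uniqueDiffOn_disc : UniqueDiffOn ℝ disc :=
  uniqueDiffOn_convex (convex_closedBall _ _) (by
    rw [disc, interior_closedBall _ one_ne_zero]; exact ⟨0, by simp⟩)

/-- Splitting into complex linear and antilinear parts; the larger of the two decides the winding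
number of the image of a circle. -/
theorem linear_eq_conj (T : ℂ →L[ℝ] ℂ) (z : ℂ) :
    T z = (T 1 - Complex.I * T Complex.I) / 2 * z +
      (T 1 + Complex.I * T Complex.I) / 2 * (starRingEnd ℂ) z := by
  have h : T z = (z.re : ℂ) * T 1 + (z.im : ℂ) * T Complex.I := by
    conv_lhs => rw [show z = z.re • (1 : ℂ) + z.im • Complex.I by
      simp [Complex.re_add_im]]
    rw [map_add, map_smul, map_smul, Complex.real_smul, Complex.real_smul]
  rw [h]
  nth_rewrite 4 [← Complex.re_add_im z]
  nth_rewrite 3 [← Complex.re_add_im z]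
  simp only [map_add, map_mul, Complex.conj_ofReal, Complex.conj_I]
  linear_combination ((z.im : ℂ) * T Complex.I) * Complex.I_sq

/-- If the moduli agree, a square root `s` of `-b / a` has modulus one and is a nonzero kernel
vector. -/
theorem norm_ne_of_injective {a b : ℂ}
    (h : ∀ z : ℂ, a * z + b * (starRingEnd ℂ) z = 0 → z = 0) : ‖a‖ ≠ ‖b‖ := by
  intro hab
  by_cases ha : a = 0
  · have hb : b = 0 := by rw [ha, norm_zero] at hab; exact norm_eq_zero.1 hab.symm
    exact one_ne_zero (h 1 (by simp [ha, hb]))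
  · obtain ⟨s, hs⟩ := IsAlgClosed.exists_pow_nat_eq (-b / a) (n := 2) (by norm_num)
    have hn : ‖s‖ ^ 2 = 1 := by
      rw [← norm_pow, hs, norm_div, norm_neg, hab, div_self]
      rw [← hab]; exact norm_ne_zero_iff.2 ha
    have hs0 : s ≠ 0 := by rintro rfl; simp at hn
    have hc : s * (starRingEnd ℂ) s = 1 := by
      rw [Complex.mul_conj, Complex.normSq_eq_norm_sq, hn]; simp
    refine hs0 (h s ?_)
    have : s * (a * s + b * (starRingEnd ℂ) s) = 0 := by
      have : a * s ^ 2 = -b := by rw [hs]; field_simp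
      linear_combination this + b * hc
    exact (mul_eq_zero.1 this).resolve_left hs0

/-- The loop stays in the disc of radius less than one about `1`, up to the factor `k`, so the
principal logarithm is periodic along it: such a factor contributes no winding. -/
theorem exists_log_one_sub_circ {c : ℂ} (hc : ‖c‖ < 1) {k : ℂ} (hk : k ≠ 0) (m : ℤ) :
    ∃ l : ℝ → ℂ, Continuous l ∧ Periodic l 1 ∧
      ∀ t, Complex.exp (l t) = k * (1 + c * circ t ^ m) := by
  have hn : ∀ t, ‖c * circ t ^ m‖ < 1 := fun t => by simpa [norm_circ] using hc
  have hcirc0 : ∀ t, circ t ≠ 0 := fun t => Complex.exp_ne_zero _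
  have hsl : ∀ t, 1 + c * circ t ^ m ∈ Complex.slitPlane := fun t =>
    Complex.mem_slitPlane_of_norm_lt_one (hn t)
  refine ⟨fun t => Complex.log k + Complex.log (1 + c * circ t ^ m), ?_, fun t => ?_, fun t => ?_⟩
  · refine continuous_const.add (Continuous.clog ?_ hsl)
    exact continuous_const.add (continuous_const.mul
      (continuous_circ.zpow₀ m fun t => Or.inl (hcirc0 t)))
  · simp only [circ_periodic t]
  · rw [Complex.exp_add, Complex.exp_log hk, Complex.exp_log (Complex.slitPlane_ne_zero (hsl t))]

/-- The image of the unit circle under an injective real linear map has winding number `±1`. -/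
theorem exists_log_linear_circ (T : ℂ →L[ℝ] ℂ) (hT : Injective T) :
    ∃ (n : ℤ) (l : ℝ → ℂ), (n = 1 ∨ n = -1) ∧ Continuous l ∧ Periodic l 1 ∧
      ∀ t : ℝ, T (Complex.I * circ t) =
        Complex.exp (2 * Real.pi * n * t * Complex.I + l t) := by
  obtain ⟨a, b, hab⟩ : ∃ a b : ℂ, ∀ z, T z = a * z + b * (starRingEnd ℂ) z :=
    ⟨_, _, linear_eq_conj T⟩
  have hne : ‖a‖ ≠ ‖b‖ := norm_ne_of_injective fun z hz => hT (by rw [hab, hz, map_zero])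
  have hcirc0 : ∀ t, circ t ≠ 0 := fun t => Complex.exp_ne_zero _
  have hconj : ∀ t, (starRingEnd ℂ) (circ t) = (circ t)⁻¹ := fun t => by
    rw [Complex.inv_def, Complex.normSq_eq_norm_sq, norm_circ]; simp
  have hinv : ∀ t : ℝ, Complex.exp (2 * Real.pi * (-1 : ℤ) * t * Complex.I) = (circ t)⁻¹ :=
    fun t => by rw [circ, ← Complex.exp_neg]; congr 1; push_cast; ring
  -- With `ζ = circ t` the image is `i a ζ - i b ζ⁻¹`. Factoring out the dominant term leaves a
  -- factor without winding.
  rcases lt_or_gt_of_ne hne with h | h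
  · have hb : b ≠ 0 := by rintro rfl; simp at h; linarith [norm_nonneg a]
    obtain ⟨l, h1, h2, h3⟩ := exists_log_one_sub_circ (c := -a / b) (k := -Complex.I * b)
      (by rw [norm_div, norm_neg, div_lt_one (by positivity)]; exact h)
      (by simp [hb]) 2
    refine ⟨-1, l, Or.inr rfl, h1, h2, fun t => ?_⟩
    rw [Complex.exp_add, h3, hinv, hab, map_mul, Complex.conj_I, hconj]
    have := hcirc0 t
    field_simp
    ring
  · have ha : a ≠ 0 := by rintro rfl; simp at h; linarith [norm_nonneg b]
    obtain ⟨l, h1, h2, h3⟩ := exists_log_one_sub_circ (c := -b / a) (k := Complex.I * a)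
      (by rw [norm_div, norm_neg, div_lt_one (by positivity)]; exact h)
      (by simp [ha]) (-2)
    refine ⟨1, l, Or.inl rfl, h1, h2, fun t => ?_⟩
    rw [Complex.exp_add, h3, Int.cast_one, mul_one, ← circ, hab, map_mul, Complex.conj_I, hconj]
    have := hcirc0 t
    field_simp

theorem deriv_comp_circ {E : Type*} [NormedAddCommGroup E] [NormedSpace ℝ E] {f : ℂ → E} {t : ℝ}
    (hf : DifferentiableWithinAt ℝ f disc (circ t)) :
    HasDerivAt (fun s => f (circ s))
      ((2 * Real.pi) • fderivWithin ℝ f disc (circ t) (Complex.I * circ t)) t := by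
  have := hf.hasFDerivWithinAt.comp_hasDerivAt t (hasDerivAt_circ t)
    (Filter.Eventually.of_forall fun s => circ_mem_disc s)
  rw [← map_smul, Complex.real_smul]
  push_cast
  exact this

/-- An immersed closed disc in the plane whose boundary runs `n ≥ 1` times along the unit circle
has `n = 1`. -/
theorem eq_one_of_immersed_disc {f : ℂ → ℂ} (hf : ContDiffOn ℝ 1 f disc)
    (himm : ∀ x ∈ disc, Injective (fderivWithin ℝ f disc x)) {n : ℕ} (hn : 1 ≤ n)
    (hbd : ∀ t, f (circ t) = circ (n * t)) : n = 1 := by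
  -- Clamping the radius to `[0, 1]` defines the homotopy on all of `ℝ × ℝ`, which is simply
  -- connected.
  have hcl : ∀ ρ : ℝ, max 0 (min 1 ρ) ∈ Icc (0 : ℝ) 1 := fun ρ =>
    ⟨le_max_left _ _, max_le zero_le_one (min_le_left _ _)⟩
  set c : ℝ × ℝ → ℂ := fun p => ((max 0 (min 1 p.1) : ℝ) : ℂ) * circ p.2 with hc
  have hcc : Continuous c := by
    have := continuous_circ
    fun_prop
  have hcd : ∀ p, c p ∈ disc := fun p => by
    have := hcl p.1
    simp only [hc, disc, mem_closedBall_zero_iff, norm_mul, norm_circ, mul_one,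
      Complex.norm_real, Real.norm_eq_abs, abs_of_nonneg this.1]
    exact this.2
  have hDc : ContinuousOn (fderivWithin ℝ f disc) disc :=
    hf.continuousOn_fderivWithin uniqueDiffOn_disc le_rfl
  -- The derivative of `f` in the direction tangent to the circle of radius `ρ`; at `ρ = 0` it is
  -- still nonzero because the direction `i ζ` is not scaled by `ρ`.
  set H : ℝ × ℝ → ℂ := fun p => fderivWithin ℝ f disc (c p) (Complex.I * circ p.2) with hH
  have hHc : Continuous H :=
    (hDc.comp_continuous hcc hcd).clm_apply
      (continuous_const.mul (continuous_circ.comp continuous_snd))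
  have hcirc0 : ∀ t, circ t ≠ 0 := fun t => Complex.exp_ne_zero _
  have hH0 : ∀ p, H p ≠ 0 := fun p h => by
    have := himm _ (hcd p) (h.trans (map_zero _).symm)
    simp [hcirc0] at this
  have hper : ∀ ρ t, H (ρ, t + 1) = H (ρ, t) := fun ρ t => by
    simp only [hH, hc, circ_periodic t]
  obtain ⟨m, l, hm, hl, hlp, hle⟩ := exists_log_linear_circ _ (himm 0 (by simp [disc]))
  have hn0 : (Complex.I * n : ℂ) ≠ 0 := by
    have : n ≠ 0 := by omega
    simp [this]
  have e1 : ∀ t : ℝ, H (1, t) = Complex.exp (2 * Real.pi * (n : ℤ) * t * Complex.I +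
      Complex.log (Complex.I * n)) := fun t => by
    have h1 := deriv_comp_circ ((hf.differentiableOn one_ne_zero) _ (circ_mem_disc t))
    have h2 : HasDerivAt (fun s => f (circ s))
        ((n : ℝ) • (2 * Real.pi * (Complex.I * circ (n * t)))) t := by
      simp only [hbd]
      exact (hasDerivAt_circ (n * t)).scomp t ((hasDerivAt_id t).const_mul (n : ℝ) |>.congr_deriv
        (by simp))
    have h3 := h1.unique h2
    have h4 : H (1, t) = fderivWithin ℝ f disc (circ t) (Complex.I * circ t) := by
      simp [hH, hc]
    rw [h4, Complex.exp_add, Complex.exp_log hn0]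
    rw [Complex.real_smul, Complex.real_smul] at h3
    have hpi : (2 * Real.pi : ℂ) ≠ 0 := by
      simp [Real.pi_ne_zero]
    apply mul_left_cancel₀ hpi
    have h5 : Complex.exp (2 * Real.pi * (n : ℤ) * t * Complex.I) = circ (n * t) := by
      rw [circ]; congr 1; push_cast; ring
    rw [h5]
    push_cast at h3
    rw [h3]; ring
  have e0 : ∀ t : ℝ, H (0, t) = Complex.exp (2 * Real.pi * m * t * Complex.I + l t) := fun t => by
    rw [← hle]; simp [hH, hc]
  have := winding_eq_of_homotopy hHc hH0 hper hl continuous_const hlp (fun _ => rfl) e0 e1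
  omega

/-! ### Minkowski algebra -/

theorem mink_add_right (u v w : V) : mink u (v + w) = mink u v + mink u w := by
  simp only [mink, Pi.add_apply]; ring

theorem mink_smul_right (a : ℝ) (v w : V) : mink v (a • w) = a * mink v w := by
  simp only [mink, Pi.smul_apply, smul_eq_mul]; ring

theorem mink_sub_left (u v w : V) : mink (u - v) w = mink u w - mink v w := by
  simp only [mink, Pi.sub_apply]; ring

theorem mink_sub_right (u v w : V) : mink u (v - w) = mink u v - mink u w := by
  simp only [mink, Pi.sub_apply]; ring

theorem mcross_add_left (u v w : V) : mcross (u + v) w = mcross u w + mcross v w := by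
  ext i; fin_cases i <;> simp [mcross] <;> ring

theorem mcross_add_right (u v w : V) : mcross u (v + w) = mcross u v + mcross u w := by
  ext i; fin_cases i <;> simp [mcross] <;> ring

theorem mcross_smul_left (a : ℝ) (v w : V) : mcross (a • v) w = a • mcross v w := by
  ext i; fin_cases i <;> simp [mcross] <;> ring

theorem mcross_smul_right (a : ℝ) (v w : V) : mcross v (a • w) = a • mcross v w := by
  ext i; fin_cases i <;> simp [mcross] <;> ring

theorem mcross_self (v : V) : mcross v v = 0 := by
  ext i; fin_cases i <;> simp [mcross] <;> ring

theorem mcross_anticomm (v w : V) : mcross w v = -mcross v w := by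
  ext i; fin_cases i <;> simp [mcross] <;> ring

theorem mcross_zero_right (v : V) : mcross v 0 = 0 := by
  ext i; fin_cases i <;> simp [mcross]

theorem mcross_mcross (u v w : V) : mcross u (mcross v w) = mink u v • w - mink u w • v := by
  ext i; fin_cases i <;> simp [mcross, mink] <;> ring

theorem mink_mcross_left (v w : V) : mink (mcross v w) v = 0 := by
  simp [mcross, mink]; ring

theorem mink_mcross_right (v w : V) : mink (mcross v w) w = 0 := by
  simp [mcross, mink]; ring

theorem mink_mcross_mcross (v w : V) :
    mink (mcross v w) (mcross v w) = mink v w ^ 2 - mink v v * mink w w := by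
  simp [mcross, mink]; ring

/-- Tangent vectors of `ℍ` are spacelike. -/
theorem mink_self_pos {y v : V} (hy : y ∈ hyp) (h : mink y v = 0) (hv : v ≠ 0) :
    0 < mink v v := by
  obtain ⟨h1, h2⟩ := hy
  simp only [mink] at *
  have hcs : (y 2 * v 2) ^ 2 ≤ (y 0 ^ 2 + y 1 ^ 2) * (v 0 ^ 2 + v 1 ^ 2) := by
    rw [show y 2 * v 2 = y 0 * v 0 + y 1 * v 1 by linarith]
    nlinarith [sq_nonneg (y 0 * v 1 - y 1 * v 0)]
  have e : y 0 ^ 2 + y 1 ^ 2 = y 2 ^ 2 - 1 := by linarith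
  rw [e] at hcs
  have hpos : 0 < v 0 ^ 2 + v 1 ^ 2 := by
    by_contra hn
    have h0 : v 0 = 0 := by nlinarith [sq_nonneg (v 0), sq_nonneg (v 1)]
    have h1' : v 1 = 0 := by nlinarith [sq_nonneg (v 0), sq_nonneg (v 1)]
    have h2' : v 2 = 0 := by
      rw [h0, h1'] at h
      have : y 2 * v 2 = 0 := by linarith
      exact (mul_eq_zero.1 this).resolve_left h2.ne'
    exact hv (by ext i; fin_cases i <;> simp [h0, h1', h2'])
  have : 0 < y 2 ^ 2 * (v 0 * v 0 + v 1 * v 1 - v 2 * v 2) := by nlinarith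
  exact (mul_pos_iff_of_pos_left (by positivity)).1 this

theorem mnorm_pos {y v : V} (hy : y ∈ hyp) (h : mink y v = 0) (hv : v ≠ 0) : 0 < mnorm v :=
  Real.sqrt_pos.2 (mink_self_pos hy h hv)

/-- On the tangent plane `J² = -1`, by the triple product identity. -/
theorem mcross_ne_zero {y v : V} (hy : y ∈ hyp) (h : mink y v = 0) (hv : v ≠ 0) :
    mcross y v ≠ 0 := by
  intro h0
  have := mcross_mcross y y v
  rw [h0, mcross_zero_right, hy.1, h] at this
  exact hv (by simpa using this)

theorem hasDerivAt_mink {f g : ℝ → V} {f' g' : V} {t : ℝ} (hf : HasDerivAt f f' t)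
    (hg : HasDerivAt g g' t) :
    HasDerivAt (fun s => mink (f s) (g s)) (mink f' (g t) + mink (f t) g') t := by
  rw [hasDerivAt_pi] at hf hg
  simp only [mink]
  refine ((((hf 0).mul (hg 0)).add ((hf 1).mul (hg 1))).sub ((hf 2).mul (hg 2))).congr_deriv ?_
  ring

theorem hasDerivAt_mcross {f g : ℝ → V} {f' g' : V} {t : ℝ} (hf : HasDerivAt f f' t)
    (hg : HasDerivAt g g' t) :
    HasDerivAt (fun s => mcross (f s) (g s)) (mcross f' (g t) + mcross (f t) g') t := by
  rw [hasDerivAt_pi] at *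
  intro i
  fin_cases i
  · refine (((hf 2).mul (hg 1)).sub ((hf 1).mul (hg 2))).congr_deriv ?_
    simp [mcross]; ring
  · refine (((hf 0).mul (hg 2)).sub ((hf 2).mul (hg 0))).congr_deriv ?_
    simp [mcross]; ring
  · refine (((hf 0).mul (hg 1)).sub ((hf 1).mul (hg 0))).congr_deriv ?_
    simp [mcross]; ring

theorem continuous_mink : Continuous fun p : V × V => mink p.1 p.2 := by
  unfold mink; fun_prop

theorem continuous_mcross : Continuous fun p : V × V => mcross p.1 p.2 := by
  refine continuous_pi fun i => ?_
  fin_cases i <;> simp [mcross] <;> fun_prop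

/-- A curve in `ℍ` is orthogonal to its velocity. -/
theorem mink_deriv_eq_zero {γ : ℝ → V} {t : ℝ} (hγ : ∀ᶠ s in 𝓝 t, γ s ∈ hyp) {v : V}
    (hd : HasDerivAt γ v t) : mink (γ t) v = 0 := by
  have h1 := hasDerivAt_mink hd hd
  have h2 : HasDerivAt (fun s => mink (γ s) (γ s)) 0 t :=
    (hasDerivAt_const t (-1 : ℝ)).congr_of_eventuallyEq (hγ.mono fun s hs => hs.1)
  have := h1.unique h2
  rw [mink_comm v] at this
  linarith

/-! ### Regularity of the solutions -/

/-- The acceleration that the equation prescribes at the point `y` with velocity `v`. -/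
def accel (k₀ : ℝ) (y v : V) : V := mink v v • y + (mnorm v * k₀) • mcross y v

/-- `γ` is a classical solution with nonvanishing velocity near `t`. -/
def SolvesAt (k₀ : ℝ) (γ : ℝ → V) (t : ℝ) : Prop :=
  (∀ᶠ s in 𝓝 t, DifferentiableAt ℝ γ s) ∧ deriv γ t ≠ 0 ∧
    HasDerivAt (deriv γ) (accel k₀ (γ t) (deriv γ t)) t

theorem continuousOn_accel (k₀ : ℝ) {f g : ℝ → V} {s : Set ℝ} (hf : ContinuousOn f s)
    (hg : ContinuousOn g s) : ContinuousOn (fun t => accel k₀ (f t) (g t)) s := by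
  have h1 : ContinuousOn (fun t => mink (g t) (g t)) s :=
    continuous_mink.comp_continuousOn (f := fun t => (g t, g t)) (hg.prodMk hg)
  have h2 : ContinuousOn (fun t => mcross (f t) (g t)) s :=
    continuous_mcross.comp_continuousOn (f := fun t => (f t, g t)) (hf.prodMk hg)
  unfold accel mnorm
  exact (h1.smul hf).add ((h1.sqrt.mul continuousOn_const).smul h2)

/-- Differentiating `⟨γ, γ̇⟩ = 0` gives `⟨γ̈, γ⟩ = -⟨γ̇, γ̇⟩`, which determines the normal part of
the acceleration. -/
theorem ae_deriv_deriv_eq_accel {k₀ a b : ℝ} (hk : 0 < k₀) {γ : ℝ → V}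
    (hγ : ∀ t ∈ Ioo a b, γ t ∈ hyp) (hd : ∀ t ∈ Ioo a b, HasDerivAt γ (deriv γ t) t)
    (hS : SolvesOn k₀ γ a b) (h0 : ∀ t ∈ Ioo a b, deriv γ t ≠ 0) :
    ∀ᵐ s ∂(volume.restrict (Ioo a b)), deriv (deriv γ) s = accel k₀ (γ s) (deriv γ s) := by
  have hnhds : ∀ s ∈ Ioo a b, Ioo a b ∈ 𝓝 s := fun s hs => isOpen_Ioo.mem_nhds hs
  have horth : ∀ s ∈ Ioo a b, mink (γ s) (deriv γ s) = 0 := fun s hs =>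
    mink_deriv_eq_zero (Filter.mem_of_superset (hnhds s hs) hγ) (hd s hs)
  filter_upwards [hS, ae_restrict_mem measurableSet_Ioo] with s hs hsI
  by_cases hdd : DifferentiableAt ℝ (deriv γ) s
  · have h1 := hasDerivAt_mink (hd s hsI) hdd.hasDerivAt
    have h2 : HasDerivAt (fun s => mink (γ s) (deriv γ s)) 0 s :=
      (hasDerivAt_const s (0 : ℝ)).congr_of_eventuallyEq
        (Filter.mem_of_superset (hnhds s hsI) horth)
    have h3 := h1.unique h2
    rw [covAcc] at hs
    rw [accel, ← hs, mink_comm _ (γ s), show mink (γ s) (deriv (deriv γ) s) =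
      -mink (deriv γ s) (deriv γ s) by linarith]
    module
  -- Where `γ̇` is not differentiable, `deriv` takes the default value `0`. The equation would then
  -- say `|γ̇| k₀ J(γ) γ̇ = 0`, which is impossible for `k₀ > 0` and `γ̇ ≠ 0`.
  · exfalso
    rw [covAcc, deriv_zero_of_not_differentiableAt hdd] at hs
    have h1 : (mnorm (deriv γ s) * k₀) • mcross (γ s) (deriv γ s) = 0 := by
      rw [← hs]; simp [mink]
    rcases smul_eq_zero.1 h1 with h | h
    · exact (mul_pos (mnorm_pos (hγ s hsI) (horth s hsI) (h0 s hsI)) hk).ne' h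
    · exact mcross_ne_zero (hγ s hsI) (horth s hsI) (h0 s hsI) h

theorem continuousOn_of_sub_eq_integral {E : Type*} [NormedAddCommGroup E] [NormedSpace ℝ E]
    {v g : ℝ → E} {a b : ℝ} (hg : IntegrableOn g (Ioo a b))
    (hv : ∀ s ∈ Ioo a b, ∀ t ∈ Ioo a b, v t - v s = ∫ u in s..t, g u) :
    ContinuousOn v (Ioo a b) := by
  intro t ht
  have hab : a ≤ b := (ht.1.trans ht.2).le
  have h1 := intervalIntegral.continuousOn_primitive_interval'
    ((intervalIntegrable_iff_integrableOn_Ioo_of_le hab).2 hg)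
    (a := t) (by rw [uIcc_of_le hab]; exact Ioo_subset_Icc_self ht)
  rw [uIcc_of_le hab] at h1
  refine ((continuousOn_const (c := v t)).add (h1.mono Ioo_subset_Icc_self)).congr
    (fun s hs => ?_) t ht
  change v s = v t + ∫ u in t..s, g u
  rw [← hv t ht s hs]; abel

/-- The integrand may be replaced by its continuous representative `h`, to which the fundamental
theorem of calculus applies at every point. -/
theorem hasDerivAt_of_sub_eq_integral {E : Type*} [NormedAddCommGroup E] [NormedSpace ℝ E]
    [CompleteSpace E] {v g h : ℝ → E} {a b : ℝ}
    (hv : ∀ s ∈ Ioo a b, ∀ t ∈ Ioo a b, v t - v s = ∫ u in s..t, g u)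
    (hae : ∀ᵐ s ∂(volume.restrict (Ioo a b)), g s = h s) (hh : ContinuousOn h (Ioo a b))
    {t : ℝ} (ht : t ∈ Ioo a b) : HasDerivAt v (h t) t := by
  have hnhds : Ioo a b ∈ 𝓝 t := isOpen_Ioo.mem_nhds ht
  have hFTC : HasDerivAt (fun s => ∫ u in t..s, h u) (h t) t :=
    intervalIntegral.integral_hasDerivAt_right (by simp)
      (hh.stronglyMeasurableAtFilter isOpen_Ioo t ht) (hh.continuousAt hnhds)
  refine (hFTC.const_add (v t)).congr_of_eventuallyEq
    (Filter.mem_of_superset hnhds fun s hs => ?_)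
  have hsub : uIoc t s ⊆ Ioo a b := fun u hu => by
    rcases le_total t s with h | h
    · rw [uIoc_of_le h] at hu; exact ⟨ht.1.trans hu.1, hu.2.trans_lt hs.2⟩
    · rw [uIoc_of_ge h] at hu; exact ⟨hs.1.trans hu.1, hu.2.trans_lt ht.2⟩
  have : ∫ u in t..s, g u = ∫ u in t..s, h u := by
    refine intervalIntegral.integral_congr_ae ?_
    filter_upwards [(ae_restrict_iff' measurableSet_Ioo).1 hae] with u hu hu'
    exact hu (hsub hu')
  change v s = v t + ∫ u in t..s, h u
  rw [← this, ← hv t ht s hs]; abel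

theorem solvesAt_of_isH22On {k₀ a b : ℝ} (hk : 0 < k₀) {γ : ℝ → V}
    (hγ : ∀ t ∈ Ioo a b, γ t ∈ hyp) (hH : IsH22On γ a b) (hS : SolvesOn k₀ γ a b)
    (h0 : ∀ t ∈ Ioo a b, deriv γ t ≠ 0) : ∀ t ∈ Ioo a b, SolvesAt k₀ γ t := by
  intro t ht
  have hd : ∀ s ∈ Ioo a b, HasDerivAt γ (deriv γ s) s :=
    fun s hs => (hH.differentiableAt s hs).hasDerivAt
  have hcont : ContinuousOn (deriv γ) (Ioo a b) :=
    continuousOn_of_sub_eq_integral (hH.memLp.integrable one_le_two) hH.deriv_sub_deriv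
  have hγc : ContinuousOn γ (Ioo a b) := fun s hs => (hd s hs).continuousAt.continuousWithinAt
  have hacc : ContinuousOn (fun s => accel k₀ (γ s) (deriv γ s)) (Ioo a b) :=
    continuousOn_accel k₀ hγc hcont
  have hev : ∀ᶠ s in 𝓝 t, s ∈ Ioo a b := isOpen_Ioo.mem_nhds ht
  exact ⟨hev.mono hH.differentiableAt, h0 t ht, hasDerivAt_of_sub_eq_integral hH.deriv_sub_deriv
    (ae_deriv_deriv_eq_accel hk hγ hd hS h0) hacc ht⟩

theorem SolvesAt.congr {k₀ : ℝ} {γ γ' : ℝ → V} {t : ℝ} (h : SolvesAt k₀ γ t)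
    (e : γ' =ᶠ[𝓝 t] γ) : SolvesAt k₀ γ' t := by
  obtain ⟨h1, h2, h3⟩ := h
  have ed : deriv γ' =ᶠ[𝓝 t] deriv γ := e.deriv
  refine ⟨?_, ?_, ?_⟩
  · filter_upwards [h1, e.eventuallyEq_nhds] with s hs hes
    exact hes.differentiableAt_iff.2 hs
  · rwa [ed.eq_of_nhds]
  · rw [ed.eq_of_nhds, e.eq_of_nhds]
    exact h3.congr_of_eventuallyEq ed

/-! ### Classification of the solutions -/

theorem IsRadius.sqrt_eq {k₀ r : ℝ} (h : IsRadius k₀ r) : Real.sqrt (1 + r ^ 2) = k₀ * r := by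
  rw [h.2]; field_simp [h.1.ne']

theorem IsRadius.sq_eq {k₀ r : ℝ} (h : IsRadius k₀ r) : k₀ ^ 2 * r ^ 2 = 1 + r ^ 2 := by
  rw [← mul_pow, ← h.sqrt_eq, Real.sq_sqrt (by positivity)]

theorem IsRadius.pos {k₀ r : ℝ} (h : IsRadius k₀ r) : 0 < k₀ := by
  rw [h.2]; have := h.1; positivity

theorem existsUnique_isRadius {k₀ : ℝ} (hk : 1 < k₀) : ∃! r : ℝ, IsRadius k₀ r := by
  have hpos : 0 < k₀ ^ 2 - 1 := by nlinarith
  have key : ∀ r, IsRadius k₀ r → r ^ 2 = (k₀ ^ 2 - 1)⁻¹ := fun r h => by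
    have := h.sq_eq
    field_simp; linarith
  refine ⟨Real.sqrt (k₀ ^ 2 - 1)⁻¹, ⟨by positivity, ?_⟩, fun r h => ?_⟩
  · rw [eq_div_iff (by positivity)]
    refine (pow_left_inj₀ (by positivity) (by positivity) two_ne_zero).1 ?_
    rw [mul_pow, Real.sq_sqrt (by positivity), Real.sq_sqrt (by positivity)]
    field_simp; ring
  · rw [← key r h, Real.sqrt_sq h.1.le]

/-- The frame of the circle of radius `r` that starts at `y` with unit velocity `e`. -/
theorem frame_mem_posFrames {y e : V} (hy : y ∈ hyp) (he : mink y e = 0) (he1 : mink e e = 1)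
    {r s : ℝ} (hs : 0 < s) (hrs : s ^ 2 = 1 + r ^ 2) :
    (e, -r • y - s • mcross y e, s • y + r • mcross y e) ∈ posFrames := by
  have h1 := mink_mcross_left y e
  have h2 := mink_mcross_right y e
  have h1' : mink y (mcross y e) = 0 := by rw [mink_comm, h1]
  have h2' : mink e (mcross y e) = 0 := by rw [mink_comm, h2]
  have he' : mink e y = 0 := by rw [mink_comm, he]
  have h3 : mink (mcross y e) (mcross y e) = 1 := by rw [mink_mcross_mcross, he, hy.1, he1]; ring
  have hww : mink (s • y + r • mcross y e) (s • y + r • mcross y e) = -1 := by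
    simp only [mink_add_left, mink_add_right, mink_smul_left, mink_smul_right, h1, h1', h3, hy.1]
    linarith
  refine ⟨?_, ?_, ?_, he1, ?_, hww, ?_, ?_⟩
  · simp only [mink_sub_right, mink_smul_right, he', h2']; ring
  · simp only [mink_add_right, mink_smul_right, he', h2']; ring
  · simp only [mink_add_right, mink_sub_left, mink_smul_left, mink_smul_right, h1, h1', h3, hy.1]
    ring
  · simp only [mink_sub_right, mink_sub_left, mink_smul_left, mink_smul_right, h1, h1', h3, hy.1]
    linarith
  · change mcross e (-r • y - s • mcross y e) = s • y + r • mcross y e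
    rw [sub_eq_add_neg, ← neg_smul, mcross_add_right, mcross_smul_right, mcross_smul_right,
      mcross_anticomm y e, mcross_mcross, he', he1]
    module
  · refine mem_hyp_of_mink_neg hy hww ?_
    simp only [mink_add_left, mink_smul_left, h1, hy.1]
    linarith

/-- The solutions of the harmonic oscillator equation. -/
theorem eq_cos_add_sin {u u' : ℝ → V} {om : ℝ} (hom : om ≠ 0) (h1 : ∀ t, HasDerivAt u (u' t) t)
    (h2 : ∀ t, HasDerivAt u' (-om ^ 2 • u t) t) (t : ℝ) :
    u t = Real.cos (om * t) • u 0 + (Real.sin (om * t) / om) • u' 0 := by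
  have hc : ∀ t, HasDerivAt (fun t => Real.cos (om * t)) (-Real.sin (om * t) * om) t := fun t => by
    simpa using ((hasDerivAt_id t).const_mul om).cos
  have hs : ∀ t, HasDerivAt (fun t => Real.sin (om * t)) (Real.cos (om * t) * om) t := fun t => by
    simpa using ((hasDerivAt_id t).const_mul om).sin
  -- Rotating the phase vector `(u, u' / om)` back by the angle `om * t` produces constants; `hA`
  -- and `hB` are its two components, the second scaled by `om`.
  have hA : ∀ t, HasDerivAt
      (fun t => Real.cos (om * t) • u t - (Real.sin (om * t) / om) • u' t) 0 t := fun t => by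
    refine (((hc t).smul (h1 t)).sub (((hs t).div_const om).smul (h2 t))).congr_deriv ?_
    match_scalars <;> field_simp <;> ring
  have hB : ∀ t, HasDerivAt
      (fun t => (om * Real.sin (om * t)) • u t + Real.cos (om * t) • u' t) 0 t := fun t => by
    refine ((((hs t).const_mul om).smul (h1 t)).add ((hc t).smul (h2 t))).congr_deriv ?_
    match_scalars <;> ring
  have eA := is_const_of_deriv_eq_zero (fun t => (hA t).differentiableAt)
    (fun t => (hA t).deriv) t 0
  have eB := is_const_of_deriv_eq_zero (fun t => (hB t).differentiableAt)
    (fun t => (hB t).deriv) t 0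
  simp only [mul_zero, Real.cos_zero, Real.sin_zero, zero_div, zero_smul, one_smul, sub_zero,
    zero_add] at eA eB
  rw [← eA, ← eB]
  have := Real.sin_sq_add_cos_sq (om * t)
  match_scalars
  · field_simp; linarith
  · field_simp; ring

/-- The periodic classical solutions in `ℍ` are the iterated circles. -/
theorem exists_eq_alphaVec {k₀ r : ℝ} (hr : IsRadius k₀ r) {γ : ℝ → V}
    (hγ : ∀ t, γ t ∈ hyp) (hS : ∀ t, SolvesAt k₀ γ t) (hper : Periodic γ 1) :
    ∃ n : ℕ, 1 ≤ n ∧ ∃ f ∈ posFrames, γ = alphaVec r (2 * Real.pi * n * r) f := by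
  have hr0 := hr.1
  have hk0 := hr.pos
  have hsq := hr.sq_eq
  have hd : ∀ t, HasDerivAt γ (deriv γ t) t := fun t => ((hS t).1.self_of_nhds).hasDerivAt
  have hdd : ∀ t, HasDerivAt (deriv γ) (accel k₀ (γ t) (deriv γ t)) t := fun t => (hS t).2.2
  have horth : ∀ t, mink (γ t) (deriv γ t) = 0 := fun t =>
    mink_deriv_eq_zero (Filter.Eventually.of_forall hγ) (hd t)
  have hspeed : ∀ t, mink (deriv γ t) (deriv γ t) = mink (deriv γ 0) (deriv γ 0) := by
    have h : ∀ t, HasDerivAt (fun t => mink (deriv γ t) (deriv γ t)) 0 t := fun t => by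
      refine (hasDerivAt_mink (hdd t) (hdd t)).congr_deriv ?_
      rw [mink_comm (deriv γ t), accel, mink_add_left, mink_smul_left, mink_smul_left, horth,
        mink_mcross_right]
      ring
    exact fun t => is_const_of_deriv_eq_zero (fun t => (h t).differentiableAt)
      (fun t => (h t).deriv) t 0
  set l := mnorm (deriv γ 0) with hl
  have hl0 : 0 < l := mnorm_pos (hγ 0) (horth 0) (hS 0).2.1
  have hl2 : mink (deriv γ 0) (deriv γ 0) = l ^ 2 :=
    (Real.sq_sqrt (mink_self_pos (hγ 0) (horth 0) (hS 0).2.1).le).symm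
  have hacc : ∀ t, accel k₀ (γ t) (deriv γ t) =
      l ^ 2 • γ t + (l * k₀) • mcross (γ t) (deriv γ t) := fun t => by
    rw [accel, mnorm, hspeed t, ← mnorm, ← hl, hl2]
  -- The conserved vector. Along the flow `J(γ)γ̇` has derivative `-(l * k₀) • γ̇`, which cancels
  -- the derivative of `k₀ • γ`.
  have hW : ∀ t, k₀ • γ t + l⁻¹ • mcross (γ t) (deriv γ t) =
      k₀ • γ 0 + l⁻¹ • mcross (γ 0) (deriv γ 0) := by
    have h : ∀ t, HasDerivAt (fun t => k₀ • γ t + l⁻¹ • mcross (γ t) (deriv γ t)) 0 t :=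
      fun t => by
        refine (((hd t).const_smul k₀).add
          ((hasDerivAt_mcross (hd t) (hdd t)).const_smul l⁻¹)).congr_deriv ?_
        rw [hacc, mcross_self, mcross_add_right, mcross_smul_right, mcross_smul_right,
          mcross_self, mcross_mcross, (hγ t).1, horth]
        match_scalars <;> field_simp <;> ring
    exact fun t => is_const_of_deriv_eq_zero (fun t => (h t).differentiableAt)
      (fun t => (h t).deriv) t 0
  set e := l⁻¹ • deriv γ 0 with he
  have he0 : mink (γ 0) e = 0 := by rw [he, mink_smul_right, horth, mul_zero]
  have he1 : mink e e = 1 := by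
    rw [he, mink_smul_left, mink_smul_right, hl2]; field_simp
  have hde : deriv γ 0 = l • e := by rw [he, smul_smul, mul_inv_cancel₀ hl0.ne', one_smul]
  have hsr : (k₀ * r) ^ 2 = 1 + r ^ 2 := by rw [mul_pow, hsq]
  have hframe := frame_mem_posFrames (hγ 0) he0 he1 (mul_pos hk0 hr0) hsr
  set f : V × V × V := (e, -r • γ 0 - (k₀ * r) • mcross (γ 0) e,
    (k₀ * r) • γ 0 + r • mcross (γ 0) e) with hf
  -- Solving the conservation law for `J(γ)γ̇` makes the equation linear: `γ̈ = -(l / r)² (γ - k₀ r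
  -- w)`, by `k₀² - 1 = 1 / r²`.
  have hWw : ∀ t, mcross (γ t) (deriv γ t) = (l / r) • f.2.2 - (l * k₀) • γ t := fun t => by
    have h1 := hW t
    rw [hde, mcross_smul_right, smul_smul, inv_mul_cancel₀ hl0.ne', one_smul] at h1
    have h2 : mcross (γ t) (deriv γ t) =
        l • ((k₀ • γ t + l⁻¹ • mcross (γ t) (deriv γ t)) - k₀ • γ t) := by
      match_scalars <;> field_simp; ring
    rw [h2, h1, hf]
    match_scalars <;> field_simp
  have hu0 : γ 0 - (k₀ * r) • f.2.2 = r • f.2.1 := by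
    rw [hf]
    match_scalars
    · linarith
    · ring
  have hf1 : f.1 = e := rfl
  clear_value f
  have hom : l / r ≠ 0 := by positivity
  have hosc := eq_cos_add_sin (u := fun t => γ t - (k₀ * r) • f.2.2) (u' := deriv γ) hom
    (fun t => by simpa using (hd t).sub_const ((k₀ * r) • f.2.2))
    (fun t => (hdd t).congr_deriv (by
      rw [hacc, hWw]
      match_scalars
      · field_simp; linarith
      · field_simp))
  have hγt : ∀ t, γ t = (k₀ * r) • f.2.2 + (r * Real.cos (l / r * t)) • f.2.1 +
      (r * Real.sin (l / r * t)) • f.1 := fun t => by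
    have h1 : γ t - (k₀ * r) • f.2.2 = _ := hosc t
    rw [hu0, hde, sub_eq_iff_eq_add] at h1
    rw [h1, hf1]
    match_scalars <;> field_simp
  -- Closing up after time one, tested against `v₁`, forces the frequency `l / r` to be a multiple
  -- of `2π`.
  have hcos : Real.cos (l / r) = 1 := by
    have h1 : mink (γ 1) f.2.1 = mink (γ 0) f.2.1 := by
      rw [show (1 : ℝ) = 0 + 1 by ring, hper 0]
    obtain ⟨h01, h0w, h1w, h00, h11, -⟩ := hframe
    rw [mink_comm] at h1w
    rw [hγt 1, hγt 0] at h1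
    simp only [mink_add_left, mink_smul_left, h01, h1w, h11, mul_zero, mul_one, Real.cos_zero,
      Real.sin_zero, zero_add, add_zero] at h1
    exact mul_left_cancel₀ hr0.ne' (by linarith)
  obtain ⟨m, hm⟩ := (Real.cos_eq_one_iff _).1 hcos
  have hm0 : 0 < m := by
    have : (0 : ℝ) < m * (2 * Real.pi) := by rw [hm]; positivity
    have h2 : (0 : ℝ) < m := (pos_iff_pos_of_mul_pos this).2 (by positivity)
    exact_mod_cast h2
  obtain ⟨n, rfl⟩ := Int.eq_ofNat_of_zero_le hm0.le
  refine ⟨n, by omega, f, hframe, ?_⟩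
  ext1 t
  rw [hγt, alphaVec, hr.sqrt_eq, ← hm]
  have : 2 * Real.pi * (n : ℝ) * r * r⁻¹ * t = ((n : ℤ) : ℝ) * (2 * Real.pi) * t := by
    field_simp
    push_cast
    ring
  rw [this]

/-! ### Distances in `ℍ` -/

/-- The reversed Cauchy–Schwarz inequality for future timelike vectors. -/
theorem mink_neg_of_mem {y w : V} (hy : y ∈ hyp) (hw : w ∈ hyp) : mink y w < 0 := by
  obtain ⟨hy1, hy2⟩ := hy
  obtain ⟨hw1, hw2⟩ := hw
  simp only [mink] at *
  have h1 : (y 0 * w 0 + y 1 * w 1) ^ 2 < (y 2 * w 2) ^ 2 := by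
    have e : (y 2 * w 2) ^ 2 =
        (1 + (y 0 ^ 2 + y 1 ^ 2)) * (1 + (w 0 ^ 2 + w 1 ^ 2)) := by
      rw [mul_pow, show y 2 ^ 2 = 1 + (y 0 ^ 2 + y 1 ^ 2) by linarith,
        show w 2 ^ 2 = 1 + (w 0 ^ 2 + w 1 ^ 2) by linarith]
    rw [e]
    nlinarith [sq_nonneg (y 0 * w 1 - y 1 * w 0), sq_nonneg (y 0), sq_nonneg (y 1),
      sq_nonneg (w 0), sq_nonneg (w 1)]
  have := abs_lt_of_sq_lt_sq h1 (by positivity)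
  linarith [(abs_lt.1 this).2]

/-- The vector `y + ⟨y, w⟩ w` is tangent to `ℍ` at `w` and has square `⟨y, w⟩² - 1`, positive unless
`y = w`. Thus `-⟨y, w⟩`, the hyperbolic cosine of the distance, can measure displacements. -/
theorem mink_lt_neg_one_of_ne {y w : V} (hy : y ∈ hyp) (hw : w ∈ hyp) (hne : y ≠ w) :
    mink y w < -1 := by
  have hneg := mink_neg_of_mem hy hw
  have horth : mink w (y + mink y w • w) = 0 := by
    rw [mink_add_right, mink_smul_right, hw.1, mink_comm w y]; ring
  by_cases hz : y + mink y w • w = 0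
  · have h1 : y = -mink y w • w := by rw [neg_smul]; exact eq_neg_of_add_eq_zero_left hz
    have h2 : mink y y = -mink y w * mink y w := by
      calc mink y y = mink (-mink y w • w) y := by rw [← h1]
        _ = _ := by rw [mink_smul_left, mink_comm w y]
    rw [hy.1] at h2
    have h3 : mink y w = -1 := by nlinarith
    exact absurd (by rw [h1, h3]; simp) hne
  · have h1 := mink_self_pos hw horth hz
    simp only [mink_add_left, mink_add_right, mink_smul_left, mink_smul_right, hw.1, hy.1,
      mink_comm w y] at h1
    nlinarith

/-! ### The circles -/

/-- The multiplication table of a positive orthonormal frame. -/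
structure FrameTable (f : V × V × V) : Prop where
  m00 : mink f.1 f.1 = 1
  m01 : mink f.1 f.2.1 = 0
  m0w : mink f.1 f.2.2 = 0
  m10 : mink f.2.1 f.1 = 0
  m11 : mink f.2.1 f.2.1 = 1
  m1w : mink f.2.1 f.2.2 = 0
  mw0 : mink f.2.2 f.1 = 0
  mw1 : mink f.2.2 f.2.1 = 0
  mww : mink f.2.2 f.2.2 = -1
  c01 : mcross f.1 f.2.1 = f.2.2
  c10 : mcross f.2.1 f.1 = -f.2.2
  cw0 : mcross f.2.2 f.1 = -f.2.1
  cw1 : mcross f.2.2 f.2.1 = f.1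

theorem frameTable {f : V × V × V} (hf : f ∈ posFrames) : FrameTable f := by
  obtain ⟨h01, h0w, h1w, h00, h11, hww, hc, hw⟩ := hf
  refine ⟨h00, h01, h0w, by rw [mink_comm, h01], h11, h1w, by rw [mink_comm, h0w],
    by rw [mink_comm, h1w], hww, hc, by rw [mcross_anticomm, hc], ?_, ?_⟩
  · rw [mcross_anticomm, ← hc, mcross_mcross, h00, h01]; simp
  · rw [mcross_anticomm, ← hc, mcross_mcross, h11, mink_comm, h01]; simp

theorem hasDerivAt_alphaVec (r lam : ℝ) (f : V × V × V) (hr : r ≠ 0) (t : ℝ) :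
    HasDerivAt (alphaVec r lam f)
      (-(lam * Real.sin (lam * r⁻¹ * t)) • f.2.1 + (lam * Real.cos (lam * r⁻¹ * t)) • f.1) t := by
  have h0 : HasDerivAt (fun t => lam * r⁻¹ * t) (lam * r⁻¹) t := by
    simpa using (hasDerivAt_id t).const_mul (lam * r⁻¹)
  refine (((h0.cos.const_mul r).smul_const f.2.1).const_add
    (Real.sqrt (1 + r ^ 2) • f.2.2) |>.add ((h0.sin.const_mul r).smul_const f.1)).congr_deriv ?_
  match_scalars <;> field_simp

theorem deriv_alphaVec (r lam : ℝ) (f : V × V × V) (hr : r ≠ 0) :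
    deriv (alphaVec r lam f) = fun t =>
      -(lam * Real.sin (lam * r⁻¹ * t)) • f.2.1 + (lam * Real.cos (lam * r⁻¹ * t)) • f.1 :=
  funext fun t => (hasDerivAt_alphaVec r lam f hr t).deriv

theorem hasDerivAt_deriv_alphaVec (r lam : ℝ) (f : V × V × V) (hr : r ≠ 0) (t : ℝ) :
    HasDerivAt (deriv (alphaVec r lam f))
      (-(lam ^ 2 / r * Real.cos (lam * r⁻¹ * t)) • f.2.1 -
        (lam ^ 2 / r * Real.sin (lam * r⁻¹ * t)) • f.1) t := by
  have h0 : HasDerivAt (fun t => lam * r⁻¹ * t) (lam * r⁻¹) t := by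
    simpa using (hasDerivAt_id t).const_mul (lam * r⁻¹)
  rw [deriv_alphaVec r lam f hr]
  refine ((h0.sin.const_mul lam).neg.smul_const f.2.1 |>.add
    ((h0.cos.const_mul lam).smul_const f.1)).congr_deriv ?_
  match_scalars <;> field_simp

theorem deriv_deriv_alphaVec (r lam : ℝ) (f : V × V × V) (hr : r ≠ 0) :
    deriv (deriv (alphaVec r lam f)) = fun t =>
      -(lam ^ 2 / r * Real.cos (lam * r⁻¹ * t)) • f.2.1 -
        (lam ^ 2 / r * Real.sin (lam * r⁻¹ * t)) • f.1 :=
  funext fun t => (hasDerivAt_deriv_alphaVec r lam f hr t).deriv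

theorem mink_deriv_alphaVec {r lam : ℝ} {f : V × V × V} (hf : f ∈ posFrames) (hr : r ≠ 0)
    (t : ℝ) : mink (deriv (alphaVec r lam f) t) (deriv (alphaVec r lam f) t) = lam ^ 2 := by
  have T := frameTable hf
  rw [deriv_alphaVec r lam f hr]
  simp only [mink_add_left, mink_add_right, mink_smul_left, mink_smul_right, T.m00, T.m01, T.m10,
    T.m11]
  linear_combination lam ^ 2 * Real.sin_sq_add_cos_sq (lam * r⁻¹ * t)

theorem mcross_alphaVec_deriv {r lam : ℝ} {f : V × V × V} (hf : f ∈ posFrames) (hr : r ≠ 0)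
    (t : ℝ) : mcross (alphaVec r lam f t) (deriv (alphaVec r lam f) t) =
      -(lam * Real.sqrt (1 + r ^ 2) * Real.cos (lam * r⁻¹ * t)) • f.2.1 -
        (lam * Real.sqrt (1 + r ^ 2) * Real.sin (lam * r⁻¹ * t)) • f.1 - (lam * r) • f.2.2 := by
  have T := frameTable hf
  rw [deriv_alphaVec r lam f hr, alphaVec]
  simp only [mcross_add_left, mcross_add_right, mcross_smul_left, mcross_smul_right, T.c01, T.c10,
    T.cw0, T.cw1, mcross_self, smul_zero]
  have := Real.sin_sq_add_cos_sq (lam * r⁻¹ * t)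
  match_scalars
  · ring
  · linear_combination (-lam * r) * this
  · ring

theorem isSolHyp_alpha {k₀ r : ℝ} (hr : IsRadius k₀ r) {n : ℕ} (f : posFrames) (hn : 1 ≤ n) :
    IsSolHyp k₀ (alpha r (2 * Real.pi * n * r) f) := by
  have hr0 := hr.1
  have hn0 : (0 : ℝ) < n := by exact_mod_cast hn
  have hlam : 0 < 2 * Real.pi * n * r := by positivity
  refine ⟨fun t => Subtype.ext ?_, fun a b => ⟨⟨fun t _ =>
    (hasDerivAt_alphaVec r _ f.1 hr0.ne' t).differentiableAt, ?_, fun s _ t _ => ?_⟩, ?_⟩⟩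
  · have h : 2 * Real.pi * n * r * r⁻¹ * (t + 1) =
        2 * Real.pi * n * r * r⁻¹ * t + n * (2 * Real.pi) := by field_simp
    simp only [alpha, alphaVec]
    rw [h, Real.cos_add_nat_mul_two_pi, Real.sin_add_nat_mul_two_pi]
  · change MemLp (deriv (deriv (alphaVec r (2 * Real.pi * n * r) f.1))) 2 _
    have hc : Continuous (deriv (deriv (alphaVec r (2 * Real.pi * n * r) f.1))) := by
      rw [deriv_deriv_alphaVec _ _ _ hr0.ne']; fun_prop
    obtain ⟨C, hC⟩ := isCompact_Icc.exists_bound_of_continuousOn (s := Icc a b) hc.continuousOn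
    refine MemLp.of_bound hc.aestronglyMeasurable C ?_
    filter_upwards [ae_restrict_mem measurableSet_Ioo] with t ht
    exact hC t (Ioo_subset_Icc_self ht)
  · change deriv (alphaVec r (2 * Real.pi * n * r) f.1) t -
      deriv (alphaVec r (2 * Real.pi * n * r) f.1) s =
        ∫ u in s..t, deriv (deriv (alphaVec r (2 * Real.pi * n * r) f.1)) u
    rw [intervalIntegral.integral_eq_sub_of_hasDerivAt]
    · exact fun u _ => (hasDerivAt_deriv_alphaVec _ _ _ hr0.ne' u).differentiableAt.hasDerivAt
    · refine Continuous.intervalIntegrable ?_ _ _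
      rw [deriv_deriv_alphaVec _ _ _ hr0.ne']; fun_prop
  · refine Filter.Eventually.of_forall fun t => ?_
    change covAcc (alphaVec r (2 * Real.pi * n * r) f.1) t =
      (mnorm (deriv (alphaVec r (2 * Real.pi * n * r) f.1) t) * k₀) •
        mcross (alphaVec r (2 * Real.pi * n * r) f.1 t)
          (deriv (alphaVec r (2 * Real.pi * n * r) f.1) t)
    generalize 2 * Real.pi * n * r = lam at hlam
    have T := frameTable f.2
    have hs := Real.sin_sq_add_cos_sq (lam * r⁻¹ * t)
    have e : mink (deriv (deriv (alphaVec r lam f.1)) t) (alphaVec r lam f.1 t) = -lam ^ 2 := by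
      rw [deriv_deriv_alphaVec _ _ _ hr0.ne', alphaVec]
      simp only [mink_sub_left, mink_add_right, mink_smul_left, mink_smul_right,
        T.m00, T.m01, T.m10, T.m11, T.m0w, T.m1w]
      generalize lam * r⁻¹ * t = θ at hs
      field_simp
      linear_combination (-r) * hs
    rw [covAcc, e, mnorm, mink_deriv_alphaVec f.2 hr0.ne', Real.sqrt_sq hlam.le,
      mcross_alphaVec_deriv f.2 hr0.ne', deriv_deriv_alphaVec _ _ _ hr0.ne', alphaVec, hr.sqrt_eq]
    have hsq := hr.sq_eq
    -- The coefficients of `v₁` and `v₀` agree exactly because `k₀² r² = 1 + r²`.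
    match_scalars
    · field_simp; linear_combination Real.cos (lam * t / r) * hsq
    · field_simp; linear_combination Real.sin (lam * t / r) * hsq
    · ring

theorem immersedCurveOn_alphaVec {r lam : ℝ} {f : V × V × V} (hf : f ∈ posFrames) (hr : r ≠ 0)
    (hlam : lam ≠ 0) (a b : ℝ) : ImmersedCurveOn (alphaVec r lam f) a b := by
  refine ⟨ContDiff.contDiffOn ?_, fun t _ h0 => ?_⟩
  · unfold alphaVec; fun_prop
  · have := mink_deriv_alphaVec (lam := lam) hf hr t
    rw [h0] at this
    exact pow_ne_zero 2 hlam (by rw [← this]; simp [mink])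

theorem circ_re (t : ℝ) : (circ t).re = Real.cos (2 * Real.pi * t) := by
  rw [circ_eq, Complex.exp_ofReal_mul_I_re]

theorem circ_im (t : ℝ) : (circ t).im = Real.sin (2 * Real.pi * t) := by
  rw [circ_eq, Complex.exp_ofReal_mul_I_im]

/-- The point `√(1 + r²|z|²) w + r (Re z) v₁ + r (Im z) v₀` of `ℍ`. -/
def capVec (r : ℝ) (f : V × V × V) (z : ℂ) : V :=
  Real.sqrt (1 + r ^ 2 * (z.re ^ 2 + z.im ^ 2)) • f.2.2 + (r * z.re) • f.2.1 + (r * z.im) • f.1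

theorem capVec_mem (r : ℝ) {f : V × V × V} (hf : f ∈ posFrames) (z : ℂ) :
    capVec r f z ∈ hyp := by
  have T := frameTable hf
  have hpos : 0 < 1 + r ^ 2 * (z.re ^ 2 + z.im ^ 2) := by positivity
  have hs := Real.sq_sqrt hpos.le
  refine mem_hyp_of_mink_neg hf.2.2.2.2.2.2.2 ?_ ?_
  · simp only [capVec, mink_add_left, mink_add_right, mink_smul_left, mink_smul_right, T.m00,
      T.m01, T.m10, T.m11, T.m0w, T.m1w, T.mw0, T.mw1, T.mww]
    linear_combination -hs
  · simp only [capVec, mink_add_left, mink_smul_left, T.m0w, T.m1w, T.mww]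
    have := Real.sqrt_pos.2 hpos
    linarith

theorem capVec_circ (r : ℝ) (hr : r ≠ 0) (f : V × V × V) (t : ℝ) :
    capVec r f (circ t) = alphaVec r (2 * Real.pi * r) f t := by
  rw [capVec, alphaVec, circ_re, circ_im, mul_inv_cancel_right₀ hr, Real.cos_sq_add_sin_sq,
    mul_one]

theorem contDiff_capVec (r : ℝ) (f : V × V × V) : ContDiff ℝ 1 (capVec r f) := by
  have hre : ContDiff ℝ 1 Complex.re := Complex.reCLM.contDiff
  have him : ContDiff ℝ 1 Complex.im := Complex.imCLM.contDiff
  have h : ContDiff ℝ 1 fun z : ℂ => Real.sqrt (1 + r ^ 2 * (z.re ^ 2 + z.im ^ 2)) :=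
    ContDiff.sqrt (by fun_prop) fun z => by positivity
  unfold capVec
  exact ((h.smul contDiff_const).add ((contDiff_const.mul hre).smul contDiff_const)).add
    ((contDiff_const.mul him).smul contDiff_const)

/-- The linear coordinate of `ℍ` that is adapted to a frame. -/
def frameCoord (r : ℝ) (f : V × V × V) : V →L[ℝ] ℂ :=
  LinearMap.toContinuousLinearMap
    { toFun := fun y => ⟨mink y f.2.1 / r, mink y f.1 / r⟩
      map_add' := fun x y => by
        apply Complex.ext <;> simp only [mink_add_left, Complex.add_re, Complex.add_im] <;> ring
      map_smul' := fun c y => by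
        apply Complex.ext <;>
          simp only [mink_smul_left, Complex.smul_re, Complex.smul_im, smul_eq_mul,
            RingHom.id_apply] <;> ring }

theorem frameCoord_apply (r : ℝ) (f : V × V × V) (y : V) :
    frameCoord r f y = ⟨mink y f.2.1 / r, mink y f.1 / r⟩ := rfl

theorem frameCoord_capVec {r : ℝ} (hr : r ≠ 0) {f : V × V × V} (hf : f ∈ posFrames) (z : ℂ) :
    frameCoord r f (capVec r f z) = z := by
  have T := frameTable hf
  apply Complex.ext <;>
    simp only [frameCoord_apply, capVec, mink_add_left, mink_smul_left, T.m00, T.m01, T.m10, T.m11,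
      T.mw0, T.mw1] <;> field_simp <;> ring

theorem frameCoord_alphaVec {r : ℝ} (hr : r ≠ 0) (n : ℕ) {f : V × V × V} (hf : f ∈ posFrames)
    (t : ℝ) : frameCoord r f (alphaVec r (2 * Real.pi * n * r) f t) = circ (n * t) := by
  have T := frameTable hf
  have e : 2 * Real.pi * n * r * r⁻¹ * t = 2 * Real.pi * (n * t) := by field_simp
  apply Complex.ext
  · simp only [circ_re, frameCoord_apply, alphaVec, mink_add_left, mink_smul_left, T.m01, T.m11,
      T.mw1, e]
    field_simp; ring
  · simp only [circ_im, frameCoord_apply, alphaVec, mink_add_left, mink_smul_left, T.m10, T.m00,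
      T.mw0, e]
    field_simp; ring

/-- The kernel of the coordinate is the line through `w`, and `⟨y, w⟩ < 0` shows that this line is
never tangent to `ℍ`. -/
theorem frameCoord_injective_tangent {r : ℝ} (hr : r ≠ 0) {f : V × V × V} (hf : f ∈ posFrames)
    {y v : V} (hy : y ∈ hyp) (hv : mink y v = 0) (h : frameCoord r f v = 0) : v = 0 := by
  have T := frameTable hf
  have h1 : mink v f.2.1 = 0 := by
    have := congrArg Complex.re h
    rw [frameCoord_apply] at this
    simpa [hr] using this
  have h0 : mink v f.1 = 0 := by
    have := congrArg Complex.im h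
    rw [frameCoord_apply] at this
    simpa [hr] using this
  have hw := hf.2.2.2.2.2.2.2
  have hc : mcross f.2.2 v = 0 := by
    rw [mcross_anticomm, ← T.c01, mcross_mcross, h0, h1]; simp
  have h2 := mcross_mcross f.2.2 f.2.2 v
  rw [hc, mcross_zero_right, T.mww, neg_one_smul] at h2
  have hvw : v = -mink f.2.2 v • f.2.2 := by
    rw [neg_smul]; linear_combination (norm := module) h2
  have h3 : mink f.2.2 v = 0 := by
    rw [hvw, mink_smul_right] at hv
    have := mink_neg_of_mem hy hw
    rcases mul_eq_zero.1 hv with h | h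
    · linarith
    · exact absurd h this.ne
  rw [hvw, h3]; simp

theorem mink_fderivWithin_eq_zero {F : ℂ → V} {s : Set ℂ} (hs : UniqueDiffOn ℝ s)
    (hF : ∀ z ∈ s, F z ∈ hyp) {x : ℂ} (hx : x ∈ s) (hd : DifferentiableWithinAt ℝ F s x) (u : ℂ) :
    mink (F x) (fderivWithin ℝ F s x u) = 0 := by
  have h := hasFDerivWithinAt_pi'.1 hd.hasFDerivWithinAt
  have h1 := ((((h 0).mul (h 0)).add ((h 1).mul (h 1))).sub ((h 2).mul (h 2)))
  have h2 : HasFDerivWithinAt (fun _ : ℂ => (-1 : ℝ)) (0 : ℂ →L[ℝ] ℝ) s x :=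
    hasFDerivWithinAt_const _ _ _
  have h3 := h2.congr (f₁ := fun z => F z 0 * F z 0 + F z 1 * F z 1 - F z 2 * F z 2)
    (fun z hz => (hF z hz).1) (hF x hx).1
  have h4 := DFunLike.congr_fun ((hs x hx).eq h1 h3) u
  simp at h4
  simp only [mink]
  linarith

/-- A disc in `ℍ` whose boundary is an `n`-fold iterated circle has `n = 1`. -/
theorem eq_one_of_isAlexHyp {r : ℝ} (hr : r ≠ 0) {n : ℕ} (hn : 1 ≤ n) {f : posFrames}
    (h : IsAlexHyp (alpha r (2 * Real.pi * n * r) f)) : n = 1 := by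
  obtain ⟨-, F, hbd, ⟨hC, himm⟩, -⟩ := h
  rw [inter_univ] at hC himm
  have hd : ∀ x ∈ disc, DifferentiableWithinAt ℝ (fun z => (F z : V)) disc x :=
    hC.differentiableOn one_ne_zero
  -- The coordinate turns the disc in `ℍ` into an immersed plane disc with boundary `t ↦ circ (n *
  -- t)`.
  refine eq_one_of_immersed_disc (f := fun z => frameCoord r f.1 (F z))
    ((frameCoord r f.1).contDiff.comp_contDiffOn hC) (fun x hx => ?_) hn (fun t => ?_)
  · have e : fderivWithin ℝ (fun z => frameCoord r f.1 (F z)) disc x =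
        (frameCoord r f.1).comp (fderivWithin ℝ (fun z => (F z : V)) disc x) :=
      ((frameCoord r f.1).hasFDerivAt.comp_hasFDerivWithinAt x
        (hd x hx).hasFDerivWithinAt).fderivWithin (uniqueDiffOn_disc x hx)
    rw [e, injective_iff_map_eq_zero]
    intro u hu
    refine (injective_iff_map_eq_zero _).1 (himm x hx) u ?_
    exact frameCoord_injective_tangent hr f.2 (F x).2
      (mink_fderivWithin_eq_zero uniqueDiffOn_disc (fun z _ => (F z).2) hx (hd x hx) u) hu
  · rw [hbd]
    exact frameCoord_alphaVec hr n f.2 t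

theorem immersedDiscOn_capVec {r : ℝ} (hr : r ≠ 0) {f : V × V × V} (hf : f ∈ posFrames) :
    ImmersedDiscOn (capVec r f) univ := by
  refine ⟨(contDiff_capVec r f).contDiffOn, fun x hx => ?_⟩
  rw [inter_univ] at hx
  have hd := (contDiff_capVec r f).differentiable one_ne_zero x
  rw [hd.fderivWithin (uniqueDiffOn_disc x hx)]
  have h1 := (frameCoord r f).hasFDerivAt.comp x hd.hasFDerivAt
  have h2 : (frameCoord r f) ∘ capVec r f = id := funext (frameCoord_capVec hr hf)
  rw [h2] at h1
  have h3 := h1.unique (hasFDerivAt_id x)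
  refine LeftInverse.injective (g := frameCoord r f) fun u => ?_
  exact DFunLike.congr_fun h3 u

theorem orientedAt_capVec {r : ℝ} (hr : 0 < r) {f : V × V × V} (hf : f ∈ posFrames) (t : ℝ) :
    OrientedAt (capVec r f) t := by
  have T := frameTable hf
  have hd := (contDiff_capVec r f).differentiable one_ne_zero (circ t)
  have hS : 0 < Real.sqrt (1 + r ^ 2) := Real.sqrt_pos.2 (by positivity)
  have hcs : (circ t).re ^ 2 + (circ t).im ^ 2 = 1 := by
    rw [circ_re, circ_im, Real.cos_sq_add_sin_sq]
  -- The image of the outer normal is the radial derivative of the cap at `s = 1`.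
  have h1 : HasDerivAt (fun s : ℝ => capVec r f ((s : ℂ) * circ t))
      (fderiv ℝ (capVec r f) (circ t) (circ t)) 1 := by
    have h2 : HasDerivAt (fun s : ℝ => (s : ℂ) * circ t) (circ t) 1 := by
      simpa using (Complex.ofRealCLM.hasDerivAt (x := (1 : ℝ))).mul_const (circ t)
    have h3 : HasFDerivAt (capVec r f) (fderiv ℝ (capVec r f) (circ t))
        (((1 : ℝ) : ℂ) * circ t) := by simpa using hd.hasFDerivAt
    exact h3.comp_hasDerivAt 1 h2
  have h2 : HasDerivAt (fun s : ℝ => capVec r f ((s : ℂ) * circ t))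
      ((r ^ 2 / Real.sqrt (1 + r ^ 2)) • f.2.2 + (r * (circ t).re) • f.2.1 +
        (r * (circ t).im) • f.1) 1 := by
    have e : (fun s : ℝ => capVec r f ((s : ℂ) * circ t)) = fun s =>
        Real.sqrt (1 + r ^ 2 * s ^ 2) • f.2.2 + (s * (r * (circ t).re)) • f.2.1 +
          (s * (r * (circ t).im)) • f.1 := by
      ext1 s
      simp only [capVec, Complex.re_ofReal_mul, Complex.im_ofReal_mul]
      rw [show (s * (circ t).re) ^ 2 + (s * (circ t).im) ^ 2 =
        s ^ 2 * ((circ t).re ^ 2 + (circ t).im ^ 2) by ring, hcs, mul_one,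
        mul_left_comm r, mul_left_comm r]
    rw [e]
    have q : HasDerivAt (fun s : ℝ => Real.sqrt (1 + r ^ 2 * s ^ 2))
        (r ^ 2 / Real.sqrt (1 + r ^ 2)) 1 := by
      have := (((hasDerivAt_pow 2 (1 : ℝ)).const_mul (r ^ 2)).const_add 1).sqrt
        (by positivity)
      convert this using 1
      simp
      field_simp
    have i := hasDerivAt_id (1 : ℝ)
    refine (((q.smul_const f.2.2).add ((i.mul_const (r * (circ t).re)).smul_const f.2.1)).add
      ((i.mul_const (r * (circ t).im)).smul_const f.1)).congr_deriv ?_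
    simp
  rw [OrientedAt, hd.fderivWithin (uniqueDiffOn_disc _ (circ_mem_disc t)), h1.unique h2]
  simp only [capVec_circ r hr.ne']
  rw [mcross_alphaVec_deriv hf hr.ne', mul_inv_cancel_right₀ hr.ne', ← circ_re, ← circ_im]
  simp only [mink_add_left, mink_sub_right, mink_smul_left, mink_smul_right, T.m00, T.m01, T.m10,
    T.m11, T.m0w, T.m1w, T.mw0, T.mw1, T.mww]
  have hS2 := Real.sq_sqrt (show 0 ≤ 1 + r ^ 2 by positivity)
  -- The pairing with `J(γ)γ̇` equals `-2π r² / √(1+r²)`.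
  have : 0 < 2 * Real.pi * r ^ 2 / Real.sqrt (1 + r ^ 2) := by positivity
  have e : 2 * Real.pi * r ^ 2 / Real.sqrt (1 + r ^ 2) =
      2 * Real.pi * r ^ 2 * (Real.sqrt (1 + r ^ 2) - r ^ 2 / Real.sqrt (1 + r ^ 2)) := by
    field_simp; linarith
  rw [e] at this
  linear_combination this - 2 * Real.pi * r ^ 2 * Real.sqrt (1 + r ^ 2) * hcs

theorem isAlexHyp_alpha {r : ℝ} (hr : 0 < r) (f : posFrames) :
    IsAlexHyp (alpha r (2 * Real.pi * r) f) :=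
  ⟨immersedCurveOn_alphaVec f.2 hr.ne' (by have := Real.pi_pos; positivity),
    fun z => ⟨capVec r f.1 z, capVec_mem r f.2 z⟩,
    fun t => Subtype.ext (capVec_circ r hr.ne' f.1 t), immersedDiscOn_capVec hr.ne' f.2,
    orientedAt_capVec hr f.2⟩

theorem alpha_one (r : ℝ) (f : posFrames) :
    alpha r (2 * Real.pi * (1 : ℕ) * r) f = alpha r (2 * Real.pi * r) f := by
  rw [Nat.cast_one, mul_one]

theorem isAlexHyp_alpha_iff {r : ℝ} (hr : 0 < r) {n : ℕ} (hn : 1 ≤ n) (f : posFrames) :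
    IsAlexHyp (alpha r (2 * Real.pi * n * r) f) ↔ n = 1 := by
  refine ⟨eq_one_of_isAlexHyp hr.ne' hn, ?_⟩
  rintro rfl
  rw [alpha_one]
  exact isAlexHyp_alpha hr f

/-! ### Simplicity of the circles and injectivity of their parametrization -/

theorem injOn_circ : InjOn circ (Ico 0 1) := by
  intro s hs t ht h
  obtain ⟨n, hn⟩ := Complex.exp_eq_exp_iff_exists_int.1 h
  have h1 : (s : ℂ) = t + n := mul_left_cancel₀ Complex.two_pi_I_ne_zero
    (by linear_combination hn)
  have h2 : s = t + n := by exact_mod_cast h1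
  have h3 : (n : ℝ) < 1 := by linarith [hs.2, ht.1]
  have h4 : (-1 : ℝ) < n := by linarith [hs.1, ht.2]
  have h5 : n < 1 := by exact_mod_cast h3
  have h6 : -1 < n := by exact_mod_cast h4
  obtain rfl : n = 0 := by omega
  simpa using h2

theorem injOn_alpha {r : ℝ} (hr : r ≠ 0) (f : posFrames) :
    InjOn (alpha r (2 * Real.pi * r) f) (Ico 0 1) := by
  intro s hs t ht h
  rw [← alpha_one] at h
  have h1 : frameCoord r f.1 (alphaVec r (2 * Real.pi * (1 : ℕ) * r) f.1 s) =
      frameCoord r f.1 (alphaVec r (2 * Real.pi * (1 : ℕ) * r) f.1 t) :=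
    congrArg (fun y : Hyp => frameCoord r f.1 y) h
  rw [frameCoord_alphaVec hr 1 f.2, frameCoord_alphaVec hr 1 f.2, Nat.cast_one, one_mul,
    one_mul] at h1
  exact injOn_circ hs ht h1

theorem alphaVec_two_pi {r : ℝ} (hr : r ≠ 0) (f : V × V × V) (t : ℝ) :
    alphaVec r (2 * Real.pi * r) f t = Real.sqrt (1 + r ^ 2) • f.2.2 +
      (r * Real.cos (2 * Real.pi * t)) • f.2.1 + (r * Real.sin (2 * Real.pi * t)) • f.1 := by
  rw [alphaVec, mul_inv_cancel_right₀ hr]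

/-- The values at the times `0`, `1/2` and `1/4` already determine `v₁`, `w` and `v₀`; no
orthogonality is needed. -/
theorem injective_alphaVec {r : ℝ} (hr : r ≠ 0) :
    Injective (alphaVec r (2 * Real.pi * r)) := by
  intro f g h
  have hS : Real.sqrt (1 + r ^ 2) ≠ 0 := (Real.sqrt_pos.2 (by positivity)).ne'
  have h0 := congrFun h 0
  have h2 := congrFun h (1 / 2)
  have h4 := congrFun h (1 / 4)
  rw [alphaVec_two_pi hr, alphaVec_two_pi hr] at h0 h2 h4
  rw [show 2 * Real.pi * (1 / 2) = Real.pi by ring] at h2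
  rw [show 2 * Real.pi * (1 / 4) = Real.pi / 2 by ring] at h4
  simp only [mul_zero, Real.cos_zero, Real.sin_zero, mul_one, zero_smul, add_zero, Real.cos_pi,
    Real.sin_pi, Real.cos_pi_div_two, Real.sin_pi_div_two] at h0 h2 h4
  have e1 : f.2.1 = g.2.1 := by
    have : (2 * r) • f.2.1 = (2 * r) • g.2.1 := by linear_combination (norm := module) h0 - h2
    exact smul_right_injective V (by simpa using hr) this
  have e2 : f.2.2 = g.2.2 := by
    rw [e1] at h0
    exact smul_right_injective V hS (add_right_cancel h0)
  have e0 : f.1 = g.1 := by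
    rw [e2] at h4
    exact smul_right_injective V hr (add_left_cancel h4)
  exact Prod.ext e0 (Prod.ext e1 e2)

/-- The oriented Alexandrov embedded solutions in `ℍ` are the circles, given that they are
classical solutions. -/
theorem exists_eq_alpha {k₀ r : ℝ} (hr : IsRadius k₀ r) {γ : ℝ → Hyp} (hper : Periodic γ 1)
    (hS : ∀ t, SolvesAt k₀ (fun t => (γ t : V)) t) (hA : IsAlexHyp γ) :
    ∃ f : posFrames, γ = alpha r (2 * Real.pi * r) f := by
  obtain ⟨n, hn, f, hf, e⟩ := exists_eq_alphaVec hr (fun t => (γ t).2) hS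
    (fun t => congrArg Subtype.val (hper t))
  have e' : γ = alpha r (2 * Real.pi * n * r) ⟨f, hf⟩ :=
    funext fun t => Subtype.ext (congrFun e t)
  rw [e'] at hA
  obtain rfl := eq_one_of_isAlexHyp hr.1.ne' hn hA
  exact ⟨⟨f, hf⟩, by rw [e', alpha_one]⟩

theorem isSolHyp_and_isAlexHyp_iff {k₀ r : ℝ} (hr : IsRadius k₀ r) (γ : ℝ → Hyp) :
    (IsSolHyp k₀ γ ∧ IsAlexHyp γ) ↔ ∃ f : posFrames, γ = alpha r (2 * Real.pi * r) f := by
  constructor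
  · rintro ⟨⟨hper, hsol⟩, hA⟩
    refine exists_eq_alpha hr hper (fun t => ?_) hA
    obtain ⟨h1, h2⟩ := hsol (t - 1) (t + 1)
    exact solvesAt_of_isH22On hr.pos (fun s _ => (γ s).2) h1 h2 (hA.1 (t - 1) (t + 1)).2 t
      ⟨by linarith, by linarith⟩
  · rintro ⟨f, rfl⟩
    exact ⟨alpha_one r f ▸ isSolHyp_alpha hr f le_rfl, isAlexHyp_alpha hr.1 f⟩

/-! ### The manifold of frames -/

theorem eq_zero_of_frame {f : V × V × V} (hf : f ∈ posFrames) {v : V} (h0 : mink v f.1 = 0)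
    (h1 : mink v f.2.1 = 0) (hw : mink v f.2.2 = 0) : v = 0 :=
  frameCoord_injective_tangent one_ne_zero hf hf.2.2.2.2.2.2.2 (by rw [mink_comm, hw])
    (by rw [frameCoord_apply, h0, h1]; simp; rfl)

theorem eq_smul_add_smul_of_frame {f : V × V × V} (hf : f ∈ posFrames) {v : V}
    (hw : mink v f.2.2 = 0) : v = mink v f.1 • f.1 + mink v f.2.1 • f.2.1 := by
  have T := frameTable hf
  rw [← sub_eq_zero]
  refine eq_zero_of_frame hf ?_ ?_ ?_ <;>
    simp only [mink_sub_left, mink_add_left, mink_smul_left, hw, T.m00, T.m01, T.m10, T.m11, T.m0w,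
      T.m1w] <;> ring

theorem rotate_mem_posFrames {f : V × V × V} (hf : f ∈ posFrames) {c s : ℝ}
    (hcs : c ^ 2 + s ^ 2 = 1) :
    (c • f.1 + s • f.2.1, -s • f.1 + c • f.2.1, f.2.2) ∈ posFrames := by
  have T := frameTable hf
  refine ⟨?_, ?_, ?_, ?_, ?_, T.mww, ?_, hf.2.2.2.2.2.2.2⟩
  · simp only [mink_add_left, mink_add_right, mink_smul_left, mink_smul_right, T.m00, T.m01, T.m10,
      T.m11]
    ring
  · simp only [mink_add_left, mink_smul_left, T.m0w, T.m1w]; ring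
  · simp only [mink_add_left, mink_smul_left, T.m0w, T.m1w]; ring
  · simp only [mink_add_left, mink_add_right, mink_smul_left, mink_smul_right, T.m00, T.m01, T.m10,
      T.m11]
    linarith
  · simp only [mink_add_left, mink_add_right, mink_smul_left, mink_smul_right, T.m00, T.m01, T.m10,
      T.m11]
    linarith
  · simp only [mcross_add_left, mcross_add_right, mcross_smul_left, mcross_smul_right, T.c01,
      T.c10, mcross_self]
    linear_combination (norm := module) hcs • f.2.2

/-- The frame at the point of `ℍ` over `(a, b)` that is the image of the standard frame under a
boost. -/
def boostFrame (a b : ℝ) : V × V × V :=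
  (![1 + a ^ 2 / (1 + Real.sqrt (1 + a ^ 2 + b ^ 2)),
      a * b / (1 + Real.sqrt (1 + a ^ 2 + b ^ 2)), a],
    ![a * b / (1 + Real.sqrt (1 + a ^ 2 + b ^ 2)),
      1 + b ^ 2 / (1 + Real.sqrt (1 + a ^ 2 + b ^ 2)), b],
    ![a, b, Real.sqrt (1 + a ^ 2 + b ^ 2)])

theorem boostFrame_mem (a b : ℝ) : boostFrame a b ∈ posFrames := by
  have hpos : 0 < 1 + a ^ 2 + b ^ 2 := by positivity
  have hs := Real.sq_sqrt hpos.le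
  have hs0 := Real.sqrt_pos.2 hpos
  rw [boostFrame]
  generalize Real.sqrt (1 + a ^ 2 + b ^ 2) = q at hs hs0
  have hb : b ^ 2 = q ^ 2 - 1 - a ^ 2 := by linarith
  have hq : 1 + q ≠ 0 := by positivity
  have hww : mink ![a, b, q] ![a, b, q] = -1 := by simp [mink]; linarith
  refine ⟨?_, ?_, ?_, ?_, ?_, hww, ?_, hww, by simpa using hs0⟩
  · simp [mink]; field_simp; linear_combination -(a * b) * hs
  · simp [mink]; field_simp; linear_combination -a * hs
  · simp [mink]; field_simp; linear_combination -b * hs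
  · simp [mink]; field_simp; linear_combination -a ^ 2 * hs
  · simp [mink]; field_simp; linear_combination -b ^ 2 * hs
  · ext i
    fin_cases i
    · simp [mcross]; field_simp; ring
    · simp [mcross]; field_simp; ring
    · simp [mcross]; field_simp; linear_combination (-1 - q) * hs

theorem contDiff_boostFrame {E : Type*} [NormedAddCommGroup E] [NormedSpace ℝ E] {a b : E → ℝ}
    (ha : ContDiff ℝ ∞ a) (hb : ContDiff ℝ ∞ b) : ContDiff ℝ ∞ fun x => boostFrame (a x) (b x) := by
  have hq : ContDiff ℝ ∞ fun x => Real.sqrt (1 + a x ^ 2 + b x ^ 2) :=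
    ContDiff.sqrt (by fun_prop) fun x => by positivity
  have hq0 : ∀ x, 1 + Real.sqrt (1 + a x ^ 2 + b x ^ 2) ≠ 0 := fun x => by positivity
  have h1 : ContDiff ℝ ∞ fun x => 1 + Real.sqrt (1 + a x ^ 2 + b x ^ 2) := contDiff_const.add hq
  unfold boostFrame
  refine ContDiff.prodMk (contDiff_pi.2 fun i => ?_)
    (ContDiff.prodMk (contDiff_pi.2 fun i => ?_) (contDiff_pi.2 fun i => ?_))
  · fin_cases i
    · exact contDiff_const.add ((ha.pow 2).div h1 hq0)
    · exact (ha.mul hb).div h1 hq0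
    · exact ha
  · fin_cases i
    · exact (ha.mul hb).div h1 hq0
    · exact contDiff_const.add ((hb.pow 2).div h1 hq0)
    · exact hb
  · fin_cases i
    · exact ha
    · exact hb
    · exact hq

theorem boostFrame_point {y : V} (hy : y ∈ hyp) : (boostFrame (y 0) (y 1)).2.2 = y := by
  have h : Real.sqrt (1 + y 0 ^ 2 + y 1 ^ 2) = y 2 := by
    rw [← Real.sqrt_sq hy.2.le]
    have := hy.1
    simp only [mink] at this
    congr 1; linarith
  ext i; fin_cases i <;> simp [boostFrame, h]

/-- Rotation of a frame in its spacelike plane. -/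
def rotFrame (c s : ℝ) (f : V × V × V) : V × V × V :=
  (c • f.1 + s • f.2.1, -s • f.1 + c • f.2.1, f.2.2)

theorem contDiff_rotFrame {E : Type*} [NormedAddCommGroup E] [NormedSpace ℝ E] {n : WithTop ℕ∞}
    {c s : E → ℝ} {f : E → V × V × V} {S : Set E} (hc : ContDiffOn ℝ n c S)
    (hs : ContDiffOn ℝ n s S) (hf : ContDiffOn ℝ n f S) :
    ContDiffOn ℝ n (fun x => rotFrame (c x) (s x) (f x)) S :=
  ((hc.smul hf.fst).add (hs.smul hf.snd.fst)).prodMk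
    (((hs.neg.smul hf.fst).add (hc.smul hf.snd.fst)).prodMk hf.snd.snd)

/-- A frame is a rotation of any other frame at the same point. -/
theorem eq_rotFrame {f g : V × V × V} (hf : f ∈ posFrames) (hg : g ∈ posFrames)
    (h : f.2.2 = g.2.2) :
    mink f.1 g.1 ^ 2 + mink f.1 g.2.1 ^ 2 = 1 ∧
      f = rotFrame (mink f.1 g.1) (mink f.1 g.2.1) g := by
  have T := frameTable hf
  have T' := frameTable hg
  have h0 := eq_smul_add_smul_of_frame hg (v := f.1) (by rw [← h, T.m0w])
  constructor
  · have := T.m00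
    rw [h0] at this
    simp only [mink_add_left, mink_add_right, mink_smul_left, mink_smul_right, T'.m00, T'.m01,
      T'.m10, T'.m11] at this
    linarith
  · refine Prod.ext h0 (Prod.ext ?_ h)
    have h1 := T.cw0
    rw [h, h0, mcross_add_right, mcross_smul_right, mcross_smul_right, T'.cw0, T'.cw1] at h1
    change f.2.1 = -mink f.1 g.2.1 • g.1 + mink f.1 g.1 • g.2.1
    linear_combination (norm := module) h1

/-- Relative to a smooth reference frame over `ℍ`, a frame is its point `w` and a rotation. Near `p`
the coordinates are the two horizontal coordinates of `w` and the sine of the rotation angle. -/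
theorem isSubmanifold3_posFrames : IsSubmanifold3 posFrames := by
  intro p hp
  obtain ⟨hcs, hrot⟩ := eq_rotFrame hp (boostFrame_mem (p.2.2 0) (p.2.2 1))
    (boostFrame_point hp.2.2.2.2.2.2.2).symm
  set c₀ := mink p.1 (boostFrame (p.2.2 0) (p.2.2 1)).1
  set s₀ := mink p.1 (boostFrame (p.2.2 0) (p.2.2 1)).2.1
  -- The boosted frames, rotated by the fixed angle that makes the reference frame over the point of
  -- `p` equal to `p` itself, so that `p` has angle zero.
  set B : ℝ → ℝ → V × V × V := fun a b => rotFrame c₀ s₀ (boostFrame a b) with hB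
  have hBmem : ∀ a b, B a b ∈ posFrames := fun a b => rotate_mem_posFrames (boostFrame_mem a b) hcs
  have hBpt : ∀ y ∈ hyp, (B (y 0) (y 1)).2.2 = y := fun y hy => boostFrame_point hy
  have hB0 : ∀ a b, (B a b).2.2 0 = a := fun a b => rfl
  have hB1 : ∀ a b, (B a b).2.2 1 = b := fun a b => rfl
  have hBsmooth : ∀ {E : Type} [NormedAddCommGroup E] [NormedSpace ℝ E] (a b : E → ℝ),
      ContDiff ℝ ∞ a → ContDiff ℝ ∞ b → ContDiff ℝ ∞ fun x => B (a x) (b x) := fun a b ha hb =>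
    contDiffOn_univ.1 (contDiff_rotFrame contDiffOn_const contDiffOn_const
      (contDiff_boostFrame ha hb).contDiffOn)
  have hminkd : ∀ {g h : V × V × V → V}, ContDiff ℝ ∞ g → ContDiff ℝ ∞ h →
      ContDiff ℝ ∞ fun x => mink (g x) (h x) := fun {g h} hg hh => by
    rw [contDiff_pi] at hg hh
    exact (((hg 0).mul (hh 0)).add ((hg 1).mul (hh 1))).sub ((hg 2).mul (hh 2))
  have hcoord : ∀ i : Fin 3, ContDiff ℝ ∞ fun f : V × V × V => f.2.2 i := fun i =>
    contDiff_pi.1 (contDiff_snd.comp contDiff_snd) i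
  have hBf : ContDiff ℝ ∞ fun f : V × V × V => B (f.2.2 0) (f.2.2 1) :=
    hBsmooth _ _ (hcoord 0) (hcoord 1)
  set φ : (Fin 3 → ℝ) → V × V × V := fun u =>
    rotFrame (Real.sqrt (1 - u 2 ^ 2)) (u 2) (B (u 0) (u 1)) with hφ
  set x : V × V × V → ℝ := fun f => mink f.1 (B (f.2.2 0) (f.2.2 1)).1 with hx
  set y : V × V × V → ℝ := fun f => mink f.1 (B (f.2.2 0) (f.2.2 1)).2.1 with hy
  set ψ : V × V × V → (Fin 3 → ℝ) := fun f => ![f.2.2 0, f.2.2 1, y f] with hψ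
  have hxs : ContDiff ℝ ∞ x := hminkd contDiff_fst hBf.fst
  have hys : ContDiff ℝ ∞ y := hminkd contDiff_fst hBf.snd.fst
  have hψs : ContDiff ℝ ∞ ψ := contDiff_pi.2 fun i => by
    fin_cases i
    · exact hcoord 0
    · exact hcoord 1
    · exact hys
  set U : Set (Fin 3 → ℝ) := {u | u 2 ^ 2 < 1} with hU
  have hsqrt : ∀ u ∈ U, Real.sqrt (1 - u 2 ^ 2) ^ 2 + u 2 ^ 2 = 1 := fun u hu => by
    rw [Real.sq_sqrt (by linarith [show u 2 ^ 2 < 1 from hu])]; ring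
  have hUo : IsOpen U := isOpen_lt (by fun_prop) continuous_const
  have hφmem : ∀ u ∈ U, φ u ∈ posFrames := fun u hu => rotate_mem_posFrames (hBmem _ _) (hsqrt u hu)
  have hxφ : ∀ u, x (φ u) = Real.sqrt (1 - u 2 ^ 2) := fun u => by
    have T := frameTable (hBmem (u 0) (u 1))
    change mink (_ • (B (u 0) (u 1)).1 + _ • (B (u 0) (u 1)).2.1) (B (u 0) (u 1)).1 = _
    rw [mink_add_left, mink_smul_left, mink_smul_left, T.m00, T.m10]; ring
  have hyφ : ∀ u, y (φ u) = u 2 := fun u => by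
    have T := frameTable (hBmem (u 0) (u 1))
    change mink (_ • (B (u 0) (u 1)).1 + _ • (B (u 0) (u 1)).2.1) (B (u 0) (u 1)).2.1 = _
    rw [mink_add_left, mink_smul_left, mink_smul_left, T.m01, T.m11]; ring
  have hψφ : ∀ u, ψ (φ u) = u := fun u => by
    ext i
    fin_cases i
    · rfl
    · rfl
    · exact hyφ u
  have hφs : ContDiffOn ℝ ∞ φ U := by
    have h2 : ContDiff ℝ ∞ fun u : Fin 3 → ℝ => u 2 := contDiff_apply ℝ ℝ 2
    refine contDiff_rotFrame (fun u hu => ?_) h2.contDiffOn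
      (hBsmooth _ _ (contDiff_apply ℝ ℝ 0) (contDiff_apply ℝ ℝ 1)).contDiffOn
    exact ((contDiff_const.sub (h2.pow 2)).contDiffAt.sqrt
      (by have : u 2 ^ 2 < 1 := hu; linarith)).contDiffWithinAt
  -- On the open set where the cosine `x` is positive, the sine `y` determines the rotation.
  refine ⟨{f | 0 < x f}, U, φ, ψ, isOpen_lt continuous_const hxs.continuous, ?_, hUo, ?_, hφs,
    fun u hu => ?_, hψs.continuous.continuousOn, fun u _ => hψφ u⟩
  · change 0 < mink p.1 (rotFrame c₀ s₀ (boostFrame (p.2.2 0) (p.2.2 1))).1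
    rw [← hrot, hp.2.2.2.1]
    exact one_pos
  · ext f
    constructor
    · rintro ⟨u, hu, rfl⟩
      refine ⟨hφmem u hu, ?_⟩
      change 0 < x (φ u)
      rw [hxφ]
      exact Real.sqrt_pos.2 (by linarith [show u 2 ^ 2 < 1 from hu])
    · rintro ⟨hf, hxf⟩
      obtain ⟨h1, h2⟩ := eq_rotFrame hf (hBmem (f.2.2 0) (f.2.2 1))
        (hBpt _ hf.2.2.2.2.2.2.2).symm
      change x f ^ 2 + y f ^ 2 = 1 at h1
      change f = rotFrame (x f) (y f) (B (f.2.2 0) (f.2.2 1)) at h2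
      replace hxf : 0 < x f := hxf
      refine ⟨ψ f, ?_, ?_⟩
      · change y f ^ 2 < 1
        nlinarith
      · change rotFrame (Real.sqrt (1 - y f ^ 2)) (y f) (B (f.2.2 0) (f.2.2 1)) = f
        rw [show 1 - y f ^ 2 = x f ^ 2 by linarith, Real.sqrt_sq hxf.le, ← h2]
  -- A smooth left inverse `ψ` makes the derivative of `φ` injective.
  · have hφd : DifferentiableAt ℝ φ u :=
      (hφs.differentiableOn (by simp) u hu).differentiableAt (hUo.mem_nhds hu)
    have hψd : DifferentiableAt ℝ ψ (φ u) := hψs.differentiable (by simp) (φ u)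
    have h1 := hψd.hasFDerivAt.comp u hφd.hasFDerivAt
    rw [show ψ ∘ φ = id from funext hψφ] at h1
    exact LeftInverse.injective (g := fderiv ℝ ψ (φ u)) fun v =>
      DFunLike.congr_fun (h1.unique (hasFDerivAt_id u)) v

/-! ### The action of `SO(2,1)₊` -/

/-- The linear map of an element of `SO(2,1)₊`. -/
def toCLM (A : SO21plus) : V →L[ℝ] V := (Matrix.mulVecLin A.1.1).toContinuousLinearMap

theorem toCLM_apply (A : SO21plus) (v : V) : toCLM A v = A.1.1 *ᵥ v := rfl

theorem coe_smul_hyp (A : SO21plus) (y : Hyp) : ((A • y : Hyp) : V) = toCLM A y := rfl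

theorem toCLM_mul (A B : SO21plus) (v : V) : toCLM (A * B) v = toCLM A (toCLM B v) := by
  simp [toCLM_apply, Matrix.mulVec_mulVec]

theorem toCLM_one (v : V) : toCLM 1 v = v := by simp [toCLM_apply]

theorem toCLM_inv_apply (A : SO21plus) (v : V) : toCLM A (toCLM A⁻¹ v) = v := by
  rw [← toCLM_mul, mul_inv_cancel, toCLM_one]

theorem toCLM_injective (A : SO21plus) : Injective (toCLM A) :=
  LeftInverse.injective (g := toCLM A⁻¹) fun v => by
    rw [← toCLM_mul, inv_mul_cancel, toCLM_one]

theorem mink_toCLM (A : SO21plus) (v w : V) : mink (toCLM A v) (toCLM A w) = mink v w :=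
  A.2.1 v w

theorem mnorm_toCLM (A : SO21plus) (v : V) : mnorm (toCLM A v) = mnorm v := by
  rw [mnorm, mink_toCLM, ← mnorm]

theorem mink_mcross_eq_det (u v w : V) : mink (mcross v w) u = -(Matrix.of ![u, v, w]).det := by
  simp [Matrix.det_fin_three, mink, mcross]; ring

theorem eq_of_forall_mink {v w : V} (h : ∀ u, mink v u = mink w u) : v = w := by
  ext i
  fin_cases i
  · simpa [mink] using h ![1, 0, 0]
  · simpa [mink] using h ![0, 1, 0]
  · simpa [mink] using h ![0, 0, 1]

/-- The cross product is determined by the form and the determinant, and `A` preserves both. -/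
theorem mcross_toCLM (A : SO21plus) (v w : V) :
    mcross (toCLM A v) (toCLM A w) = toCLM A (mcross v w) := by
  refine eq_of_forall_mink fun u => ?_
  rw [← toCLM_inv_apply A u, mink_toCLM, mink_mcross_eq_det, mink_mcross_eq_det]
  generalize toCLM A⁻¹ u = u'
  have h : Matrix.of ![toCLM A u', toCLM A v, toCLM A w] =
      Matrix.of ![u', v, w] * A.1.1ᵀ := by
    ext i j
    fin_cases i <;>
      simp [toCLM_apply, Matrix.mul_apply, Matrix.mulVec, dotProduct, mul_comm]
  rw [h, Matrix.det_mul, Matrix.det_transpose, A.1.2, mul_one]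

theorem toCLM_mem_posFrames (A : SO21plus) {f : V × V × V} (hf : f ∈ posFrames) :
    (toCLM A f.1, toCLM A f.2.1, toCLM A f.2.2) ∈ posFrames := by
  obtain ⟨h1, h2, h3, h4, h5, h6, h7, h8⟩ := hf
  refine ⟨?_, ?_, ?_, ?_, ?_, ?_, ?_, A.2.2 _ h8⟩ <;>
    simp only [mink_toCLM, mcross_toCLM, *]

/-- The action of `SO(2,1)₊` on the positive orthonormal frames. -/
def moveFrame (A : SO21plus) (f : posFrames) : posFrames := ⟨_, toCLM_mem_posFrames A f.2⟩

theorem smul_alpha (A : SO21plus) (r lam : ℝ) (f : posFrames) (t : ℝ) :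
    A • alpha r lam f t = alpha r lam (moveFrame A f) t := by
  refine Subtype.ext ?_
  rw [coe_smul_hyp]
  simp only [alpha, alphaVec, map_add, map_smul, moveFrame]

theorem SolvesAt.toCLM {k₀ : ℝ} {γ : ℝ → V} {t : ℝ} (A : SO21plus) (h : SolvesAt k₀ γ t) :
    SolvesAt k₀ (fun s => toCLM A (γ s)) t := by
  obtain ⟨h1, h2, h3⟩ := h
  have hd : ∀ s, DifferentiableAt ℝ γ s →
      HasDerivAt (fun s => MagneticHyp.toCLM A (γ s)) (MagneticHyp.toCLM A (deriv γ s)) s :=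
    fun s hs => (MagneticHyp.toCLM A).hasFDerivAt.comp_hasDerivAt s hs.hasDerivAt
  have he : deriv (fun s => MagneticHyp.toCLM A (γ s)) =ᶠ[𝓝 t]
      fun s => MagneticHyp.toCLM A (deriv γ s) := h1.mono fun s hs => (hd s hs).deriv
  refine ⟨h1.mono fun s hs => (hd s hs).differentiableAt, ?_, ?_⟩
  · rw [he.eq_of_nhds]
    exact (map_ne_zero_iff _ (toCLM_injective A)).2 h2
  · refine HasDerivAt.congr_of_eventuallyEq ?_ he
    refine ((MagneticHyp.toCLM A).hasFDerivAt.comp_hasDerivAt t h3).congr_deriv ?_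
    rw [he.eq_of_nhds, accel, accel, mink_toCLM, mnorm_toCLM, mcross_toCLM, map_add, map_smul,
      map_smul]

/-! ### The covering `ℍ → ℍ / Γ` -/

theorem isClosed_hyp : IsClosed hyp := by
  have : hyp = {y : V | mink y y = -1} ∩ {y : V | 0 ≤ y 2} := by
    ext y
    refine ⟨fun h => ⟨h.1, h.2.le⟩, fun h => ⟨h.1, lt_of_le_of_ne h.2 fun h0 => ?_⟩⟩
    have h1 : mink y y = -1 := h.1
    simp only [mink, ← h0] at h1
    nlinarith [sq_nonneg (y 0), sq_nonneg (y 1)]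
  rw [this]
  exact (isClosed_eq (continuous_mink.comp (continuous_id.prodMk continuous_id))
    continuous_const).inter (isClosed_le continuous_const (continuous_apply 2))

instance : LocallyCompactSpace Hyp := isClosed_hyp.isClosedEmbedding_subtypeVal.locallyCompactSpace

theorem continuous_smul_hyp (A : SO21plus) : Continuous fun y : Hyp => A • y :=
  ((toCLM A).continuous.comp continuous_subtype_val).subtype_mk _

instance (Γ : Subgroup SO21plus) : ContinuousConstSMul Γ Hyp :=
  ⟨fun A => continuous_smul_hyp A.1⟩

theorem isQuotientCoveringMap_proj {Γ : Subgroup SO21plus}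
    (hfree : ∀ (A : Γ) (y : Hyp), A • y = y → A = 1) (hpd : ProperlyDiscontinuousSMul Γ Hyp) :
    IsQuotientCoveringMap (proj Γ) Γ :=
  have : IsCancelSMul Γ Hyp := isCancelSMul_iff_eq_one_of_smul_eq.2 hfree
  isQuotientCoveringMap_quotientMk_of_properlyDiscontinuousSMul

theorem proj_smul {Γ : Subgroup SO21plus} {A : SO21plus} (hA : A ∈ Γ) (y : Hyp) :
    proj Γ (A • y) = proj Γ y :=
  Quotient.sound ⟨⟨A, hA⟩, rfl⟩

theorem exists_smul_eq_of_proj_eq {Γ : Subgroup SO21plus} {y z : Hyp} (h : proj Γ y = proj Γ z) :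
    ∃ A ∈ Γ, y = A • z := by
  obtain ⟨A, hA⟩ := Quotient.exact h
  exact ⟨A.1, A.2, hA.symm⟩

/-- Two lifts of a map on a preconnected set differ by one element of `Γ`. -/
theorem exists_smul_eqOn {Γ : Subgroup SO21plus} (hq : IsQuotientCoveringMap (proj Γ) Γ)
    {X : Type*} [TopologicalSpace X] {s : Set X} (hs : IsPreconnected s) {g₁ g₂ : X → Hyp}
    (h₁ : ContinuousOn g₁ s) (h₂ : ContinuousOn g₂ s)
    (h : ∀ x ∈ s, proj Γ (g₁ x) = proj Γ (g₂ x)) : ∃ A ∈ Γ, ∀ x ∈ s, g₁ x = A • g₂ x := by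
  rcases s.eq_empty_or_nonempty with rfl | ⟨x₀, hx₀⟩
  · exact ⟨1, Γ.one_mem, fun x hx => hx.elim⟩
  · obtain ⟨A, hA, e⟩ := exists_smul_eq_of_proj_eq (h x₀ hx₀)
    refine ⟨A, hA, hq.isCoveringMap.eqOn_of_comp_eqOn hs h₁
      ((continuous_smul_hyp A).comp_continuousOn h₂) (fun x hx => ?_) hx₀ e⟩
    simp only [Function.comp_apply, proj_smul hA, h x hx]

theorem continuousOn_hyp_iff {X : Type*} [TopologicalSpace X] {s : Set X} {g : X → Hyp} :
    ContinuousOn g s ↔ ContinuousOn (fun x => (g x : V)) s :=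
  Topology.IsInducing.subtypeVal.continuousOn_iff

/-- Maps from the disc to `ℍ / Γ` lift to `ℍ`. -/
theorem exists_lift_disc {Γ : Subgroup SO21plus} (hq : IsQuotientCoveringMap (proj Γ) Γ)
    {F : ℂ → QuotHyp Γ} (hF : ContinuousOn F disc) :
    ∃ F' : ℂ → Hyp, Continuous F' ∧ ∀ z ∈ disc, proj Γ (F' z) = F z := by
  -- The radial retraction onto the disc extends `F` continuously to the plane, where lifts through
  -- a covering exist.
  set ρ : ℂ → ℂ := fun z => ((max 1 ‖z‖)⁻¹ : ℝ) • z with hρ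
  have hpos : ∀ z : ℂ, 0 < max 1 ‖z‖ := fun z => lt_max_of_lt_left one_pos
  have hρc : Continuous ρ :=
    ((continuous_const.max continuous_norm).inv₀ fun z => (hpos z).ne').smul continuous_id
  have hρd : ∀ z, ρ z ∈ disc := fun z => by
    rw [disc, mem_closedBall_zero_iff, hρ]
    simp only [norm_smul, norm_inv, Real.norm_eq_abs, abs_of_pos (hpos z)]
    rw [inv_mul_le_one₀ (hpos z)]
    exact le_max_right _ _
  have hρid : ∀ z ∈ disc, ρ z = z := fun z hz => by
    rw [disc, mem_closedBall_zero_iff] at hz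
    simp [hρ, max_eq_left hz]
  obtain ⟨e₀, he₀⟩ := hq.surjective (F (ρ 0))
  obtain ⟨F', ⟨-, hF'⟩, -⟩ := hq.isCoveringMap.existsUnique_continuousMap_lifts
    ⟨fun z => F (ρ z), hF.comp_continuous hρc hρd⟩ 0 e₀ he₀
  refine ⟨F', F'.continuous, fun z hz => ?_⟩
  have := congrFun hF' z
  simp only [Function.comp_apply, ContinuousMap.coe_mk, hρid z hz] at this
  exact this

/-- Near `x` the continuous lift `F` is the image of the local lift `G` under one isometry in `Γ`,
and regularity, immersion and orientation are invariant under it. -/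
theorem contDiffOn_and_oriented_of_lift {Γ : Subgroup SO21plus}
    (hq : IsQuotientCoveringMap (proj Γ) Γ) {F : ℂ → Hyp} (hF : Continuous F) {U : Set ℂ}
    (hU : IsOpen U) {x : ℂ} (hx : x ∈ disc) (hxU : x ∈ U) {G : ℂ → Hyp}
    (hG : ∀ z ∈ disc ∩ U, proj Γ (G z) = proj Γ (F z))
    (himm : ImmersedDiscOn (fun z => (G z : V)) U)
    (hor : ∀ t, circ t ∈ U → OrientedAt (fun z => (G z : V)) t) :
    ContDiffWithinAt ℝ 1 (fun z => (F z : V)) disc x ∧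
      Injective (fderivWithin ℝ (fun z => (F z : V)) disc x) ∧
      ∀ t, circ t = x → OrientedAt (fun z => (F z : V)) t := by
  obtain ⟨ε, hε, hball⟩ := Metric.isOpen_iff.1 hU x hxU
  have hsub : disc ∩ Metric.ball x ε ⊆ disc ∩ U := inter_subset_inter_right _ hball
  obtain ⟨A, hA, hAe⟩ := exists_smul_eqOn hq
    -- A ball replaces `U` so that its intersection with the disc is convex, hence connected.
    ((convex_closedBall (0 : ℂ) 1).inter (convex_ball x ε)).isPreconnected (g₁ := F) (g₂ := G)
    hF.continuousOn (continuousOn_hyp_iff.2 (himm.1.continuousOn.mono hsub))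
    (fun z hz => (hG z (hsub hz)).symm)
  have hmem : disc ∩ Metric.ball x ε ∈ 𝓝[disc] x :=
    inter_mem_nhdsWithin _ (Metric.ball_mem_nhds x hε)
  have he : (fun z => (F z : V)) =ᶠ[𝓝[disc] x] fun z => toCLM A (G z) :=
    Filter.mem_of_superset hmem fun z hz => congrArg Subtype.val (hAe z hz)
  have hGd : ContDiffWithinAt ℝ 1 (fun z => (G z : V)) disc x :=
    (contDiffWithinAt_inter (hU.mem_nhds hxU)).1 (himm.1 x ⟨hx, hxU⟩)
  have hGx : (F x : V) = toCLM A (G x) :=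
    congrArg Subtype.val (hAe x ⟨hx, Metric.mem_ball_self hε⟩)
  have hGdiff : DifferentiableWithinAt ℝ (fun z => (G z : V)) disc x :=
    hGd.differentiableWithinAt one_ne_zero
  have hfd : fderivWithin ℝ (fun z => (F z : V)) disc x =
      (toCLM A).comp (fderivWithin ℝ (fun z => (G z : V)) disc x) := by
    rw [he.fderivWithin_eq hGx]
    exact ((toCLM A).hasFDerivAt.comp_hasFDerivWithinAt x
      hGdiff.hasFDerivWithinAt).fderivWithin (uniqueDiffOn_disc x hx)
  refine ⟨((toCLM A).contDiff.contDiffAt.comp_contDiffWithinAt x hGd).congr_of_eventuallyEq he hGx,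
    ?_, ?_⟩
  · rw [hfd]
    exact (toCLM_injective A).comp (himm.2 x ⟨hx, hxU⟩)
  · rintro t rfl
    have h1 := hor t hxU
    have h2 : deriv (fun s => (F (circ s) : V)) t =
        toCLM A (deriv (fun s => (G (circ s) : V)) t) := by
      have e : (fun s => (F (circ s) : V)) =ᶠ[𝓝 t] fun s => toCLM A (G (circ s)) := by
        have := continuous_circ.continuousAt (Metric.ball_mem_nhds (circ t) hε)
        filter_upwards [this] with s hs
        exact congrArg Subtype.val (hAe _ ⟨circ_mem_disc s, hs⟩)
      rw [e.deriv_eq]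
      exact ((toCLM A).hasFDerivAt.comp_hasDerivAt t
        (deriv_comp_circ hGdiff).differentiableAt.hasDerivAt).deriv
    simp only [OrientedAt] at h1 ⊢
    rw [hfd, h2, hGx, mcross_toCLM, ContinuousLinearMap.comp_apply, mink_toCLM]
    exact h1

/-- The disc of an oriented Alexandrov embedded curve in `ℍ / Γ` lifts to `ℍ`. -/
theorem exists_lift_of_isAlexQuot {Γ : Subgroup SO21plus}
    (hq : IsQuotientCoveringMap (proj Γ) Γ) {c : ℝ → QuotHyp Γ} (h : IsAlexQuot Γ c) :
    ∃ F : ℂ → Hyp, Continuous F ∧ (∀ t, proj Γ (F (circ t)) = c t) ∧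
      ImmersedDiscOn (fun z => (F z : V)) univ ∧ ∀ t, OrientedAt (fun z => (F z : V)) t := by
  obtain ⟨-, F₀, hbd, hloc⟩ := h
  have hF₀ : ContinuousOn F₀ disc := fun x hx => by
    obtain ⟨U, hU, hxU, G, hG, himm, -⟩ := hloc x hx
    have h1 : ContinuousOn F₀ (disc ∩ U) :=
      (hq.continuous.comp_continuousOn (continuousOn_hyp_iff.2 himm.1.continuousOn)).congr
        fun z hz => (hG z hz).symm
    exact (continuousWithinAt_inter (hU.mem_nhds hxU)).1 (h1 x ⟨hx, hxU⟩)
  obtain ⟨F, hF, hFF⟩ := exists_lift_disc hq hF₀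
  have key : ∀ x ∈ disc, ContDiffWithinAt ℝ 1 (fun z => (F z : V)) disc x ∧
      Injective (fderivWithin ℝ (fun z => (F z : V)) disc x) ∧
      ∀ t, circ t = x → OrientedAt (fun z => (F z : V)) t := fun x hx => by
    obtain ⟨U, hU, hxU, G, hG, himm, hor⟩ := hloc x hx
    exact contDiffOn_and_oriented_of_lift hq hF hU hx hxU
      (fun z hz => (hG z hz).trans (hFF z hz.1).symm) himm hor
  refine ⟨F, hF, fun t => by rw [hFF _ (circ_mem_disc t), hbd], ⟨?_, ?_⟩,
    fun t => (key _ (circ_mem_disc t)).2.2 t rfl⟩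
  · rw [inter_univ]; exact fun x hx => (key x hx).1
  · rw [inter_univ]; exact fun x hx => (key x hx).2.1

theorem IsH22On.mono {γ : ℝ → V} {a b a' b' : ℝ} (h : IsH22On γ a b)
    (hsub : Ioo a' b' ⊆ Ioo a b) : IsH22On γ a' b' :=
  ⟨fun t ht => h.1 t (hsub ht), h.2.mono_measure (Measure.restrict_mono hsub le_rfl),
    fun s hs t ht => h.3 s (hsub hs) t (hsub ht)⟩

theorem IsSolHyp.isSolQuot (Γ : Subgroup SO21plus) {k₀ : ℝ} {γ : ℝ → Hyp} (h : IsSolHyp k₀ γ) :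
    IsSolQuot Γ k₀ (proj Γ ∘ γ) :=
  ⟨fun t => congrArg (proj Γ) (h.1 t), fun t => ⟨t - 1, t + 1, ⟨by linarith, by linarith⟩, γ,
    fun _ _ => rfl, h.2 _ _⟩⟩

theorem IsAlexHyp.isAlexQuot (Γ : Subgroup SO21plus) {γ : ℝ → Hyp} (h : IsAlexHyp γ) :
    IsAlexQuot Γ (proj Γ ∘ γ) := by
  obtain ⟨h1, F, hbd, himm, hor⟩ := h
  refine ⟨fun t => ⟨t - 1, t + 1, ⟨by linarith, by linarith⟩, γ, fun _ _ => rfl, h1 _ _⟩,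
    fun z => proj Γ (F z), fun t => congrArg (proj Γ) (hbd t), fun x _ => ⟨univ, isOpen_univ,
      mem_univ x, F, fun _ _ => rfl, himm, fun t _ => hor t⟩⟩

/-- Continuous lifts of immersed solutions in `ℍ / Γ` are classical solutions. -/
theorem solvesAt_of_lift {Γ : Subgroup SO21plus} (hq : IsQuotientCoveringMap (proj Γ) Γ) {k₀ : ℝ}
    (hk : 0 < k₀) {c : ℝ → QuotHyp Γ} (hS : IsSolQuot Γ k₀ c) (hA : IsAlexQuot Γ c) {γ : ℝ → Hyp}
    (hγ : Continuous γ) (hc : ∀ t, proj Γ (γ t) = c t) (t : ℝ) :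
    SolvesAt k₀ (fun s => (γ s : V)) t := by
  obtain ⟨a, b, hab, γ₁, h₁, hH, hSol⟩ := hS.2 t
  obtain ⟨a', b', hab', γ₂, h₂, hI, hne⟩ := hA.1 t
  have hs1 : Ioo (max a a') (min b b') ⊆ Ioo a b :=
    Ioo_subset_Ioo (le_max_left _ _) (min_le_left _ _)
  have hs2 : Ioo (max a a') (min b b') ⊆ Ioo a' b' :=
    Ioo_subset_Ioo (le_max_right _ _) (min_le_right _ _)
  have ht : t ∈ Ioo (max a a') (min b b') :=
    ⟨max_lt hab.1 hab'.1, lt_min hab.2 hab'.2⟩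
  have hc1 : ContinuousOn γ₁ (Ioo (max a a') (min b b')) := continuousOn_hyp_iff.2 fun s hs =>
    (hH.differentiableAt s (hs1 hs)).continuousAt.continuousWithinAt
  have hc2 : ContinuousOn γ₂ (Ioo (max a a') (min b b')) :=
    continuousOn_hyp_iff.2 (hI.continuousOn.mono hs2)
  -- The local lift that solves the equation and the one that is immersed may differ; on a common
  -- interval both are isometric images of each other and of `γ`.
  obtain ⟨A, -, hAe⟩ := exists_smul_eqOn hq isPreconnected_Ioo hγ.continuousOn hc1
    fun s hs => (hc s).trans (h₁ s (hs1 hs)).symm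
  obtain ⟨B, -, hBe⟩ := exists_smul_eqOn hq isPreconnected_Ioo hc1 hc2
    fun s hs => (h₁ s (hs1 hs)).trans (h₂ s (hs2 hs)).symm
  have hne1 : ∀ s ∈ Ioo (max a a') (min b b'), deriv (fun s => (γ₁ s : V)) s ≠ 0 := by
    intro s hs
    have e : (fun s => (γ₁ s : V)) =ᶠ[𝓝 s] fun s => toCLM B (γ₂ s) :=
      Filter.mem_of_superset (isOpen_Ioo.mem_nhds hs) fun u hu => congrArg Subtype.val (hBe u hu)
    have hd : DifferentiableAt ℝ (fun s => (γ₂ s : V)) s :=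
      (hI.differentiableOn one_ne_zero s (hs2 hs)).differentiableAt
        (isOpen_Ioo.mem_nhds (hs2 hs))
    have hB : deriv (fun s => toCLM B (γ₂ s)) s = toCLM B (deriv (fun s => (γ₂ s : V)) s) :=
      ((toCLM B).hasFDerivAt.comp_hasDerivAt s hd.hasDerivAt).deriv
    rw [e.deriv_eq, hB]
    exact (map_ne_zero_iff _ (toCLM_injective B)).2 (hne s (hs2 hs))
  have h3 := solvesAt_of_isH22On hk (fun s _ => (γ₁ s).2) (hH.mono hs1)
    (ae_mono (Measure.restrict_mono hs1 le_rfl) hSol) hne1 t ht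
  exact (h3.toCLM A).congr
    (Filter.mem_of_superset (isOpen_Ioo.mem_nhds ht) fun u hu => congrArg Subtype.val (hAe u hu))

theorem immersedCurveOn_of_solvesAt {k₀ : ℝ} {γ : ℝ → V} (h : ∀ t, SolvesAt k₀ γ t) (a b : ℝ) :
    ImmersedCurveOn γ a b :=
  ⟨(contDiff_one_iff_deriv.2 ⟨fun t => (h t).1.self_of_nhds,
    continuous_iff_continuousAt.2 fun t => (h t).2.2.continuousAt⟩).contDiffOn,
    fun t _ => (h t).2.1⟩

/-- The boundary of the lifted disc is a lift of `c` that closes up, so the classification in `ℍ`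
applies to it. -/
theorem isSolQuot_and_isAlexQuot_iff {Γ : Subgroup SO21plus}
    (hq : IsQuotientCoveringMap (proj Γ) Γ) {k₀ r : ℝ} (hr : IsRadius k₀ r) (c : ℝ → QuotHyp Γ) :
    (IsSolQuot Γ k₀ c ∧ IsAlexQuot Γ c) ↔
      ∃ f : posFrames, c = proj Γ ∘ alpha r (2 * Real.pi * r) f := by
  constructor
  · rintro ⟨hS, hA⟩
    obtain ⟨F, hF, hFc, himm, hor⟩ := exists_lift_of_isAlexQuot hq hA
    have hsol := solvesAt_of_lift hq hr.pos hS hA (hF.comp continuous_circ) hFc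
    obtain ⟨f, hf⟩ := exists_eq_alpha hr (γ := F ∘ circ)
      (fun t => congrArg F (circ_periodic t)) hsol
      ⟨immersedCurveOn_of_solvesAt hsol, F, fun _ => rfl, himm, hor⟩
    exact ⟨f, funext fun t => by
      rw [← hf, Function.comp_apply, Function.comp_apply, hFc]⟩
  · rintro ⟨f, rfl⟩
    exact ⟨(alpha_one r f ▸ isSolHyp_alpha hr f le_rfl : IsSolHyp k₀ _).isSolQuot Γ,
      (isAlexHyp_alpha hr.1 f).isAlexQuot Γ⟩

theorem continuous_alpha (r lam : ℝ) (f : posFrames) : Continuous (alpha r lam f) :=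
  Continuous.subtype_mk (by unfold alphaVec; fun_prop) _

theorem isAlexQuot_alpha_iff {Γ : Subgroup SO21plus} (hq : IsQuotientCoveringMap (proj Γ) Γ)
    {r : ℝ} (hr : 0 < r) {n : ℕ} (hn : 1 ≤ n) (f : posFrames) :
    IsAlexQuot Γ (proj Γ ∘ alpha r (2 * Real.pi * n * r) f) ↔ n = 1 := by
  refine ⟨fun h => ?_, fun h => ((isAlexHyp_alpha_iff hr hn f).2 h).isAlexQuot Γ⟩
  obtain ⟨F, hF, hFc, himm, hor⟩ := exists_lift_of_isAlexQuot hq h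
  obtain ⟨A, -, hAe⟩ := exists_smul_eqOn hq isPreconnected_univ
    (hF.comp continuous_circ).continuousOn (continuous_alpha r (2 * Real.pi * n * r) f).continuousOn
    fun t _ => hFc t
  have hn0 : (n : ℝ) ≠ 0 := by exact_mod_cast (by omega : n ≠ 0)
  refine eq_one_of_isAlexHyp hr.ne' hn (f := moveFrame A f)
    ⟨immersedCurveOn_alphaVec (moveFrame A f).2 hr.ne' (by simp [Real.pi_ne_zero, hn0, hr.ne']), F,
      fun t => ?_, himm, hor⟩
  rw [← smul_alpha]
  exact hAe t (mem_univ t)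

theorem proj_alpha_eq_iff {Γ : Subgroup SO21plus} (hq : IsQuotientCoveringMap (proj Γ) Γ)
    {r : ℝ} (hr : 0 < r) (f f' : posFrames) :
    proj Γ ∘ alpha r (2 * Real.pi * r) f = proj Γ ∘ alpha r (2 * Real.pi * r) f' ↔
      ∃ A ∈ Γ, (f' : V × V × V) =
        (A.1.1.mulVec f.1.1, A.1.1.mulVec f.1.2.1, A.1.1.mulVec f.1.2.2) := by
  constructor
  · intro h
    obtain ⟨A, hA, hAe⟩ := exists_smul_eqOn hq isPreconnected_univ
      (continuous_alpha r (2 * Real.pi * r) f').continuousOn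
      (continuous_alpha r (2 * Real.pi * r) f).continuousOn fun t _ => (congrFun h t).symm
    refine ⟨A, hA, injective_alphaVec hr.ne' (funext fun t => ?_)⟩
    have := hAe t (mem_univ t)
    rw [smul_alpha] at this
    exact congrArg Subtype.val this
  · rintro ⟨A, hA, h⟩
    have : f' = moveFrame A f := Subtype.ext h
    ext1 t
    rw [this, Function.comp_apply, Function.comp_apply, ← smul_alpha, proj_smul hA]

/-! ### The injectivity radius of a compact quotient -/

theorem isCompact_sublevel (R : ℝ) : IsCompact {y : Hyp | y.1 2 ≤ R} := by
  refine (isClosed_hyp.isClosedEmbedding_subtypeVal.isCompact_preimage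
    (isCompact_closedBall (0 : V) R)).of_isClosed_subset
    (isClosed_le ((continuous_apply 2).comp continuous_subtype_val) continuous_const) ?_
  intro y hy
  have h1 := y.2.1
  have h2 := y.2.2
  have hy : y.1 2 ≤ R := hy
  simp only [mink] at h1
  rw [mem_preimage, mem_closedBall_zero_iff, pi_norm_le_iff_of_nonneg (h2.le.trans hy)]
  intro i
  refine le_trans ?_ hy
  rw [Real.norm_eq_abs]
  refine abs_le_of_sq_le_sq ?_ h2.le
  fin_cases i <;> simp <;> nlinarith [sq_nonneg (y.1 0), sq_nonneg (y.1 1)]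

/-- Points of very different height are far apart. By Cauchy–Schwarz it suffices that `(y₃² - 1)(z₃²
- 1) ≤ (y₃ z₃ - 2)²`, that is `4 y₃ z₃ ≤ y₃² + z₃² + 3`, which is where the factor `4` comes from.
-/
theorem mink_le_neg_two {y z : V} (hy : y ∈ hyp) (hz : z ∈ hyp) (h : 4 * y 2 ≤ z 2) :
    mink y z ≤ -2 := by
  obtain ⟨hy1, hy2⟩ := hy
  obtain ⟨hz1, hz2⟩ := hz
  simp only [mink] at *
  have hy1' : y 0 ^ 2 + y 1 ^ 2 = y 2 ^ 2 - 1 := by linarith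
  have hz1' : z 0 ^ 2 + z 1 ^ 2 = z 2 ^ 2 - 1 := by linarith
  have hyge : 1 ≤ y 2 := by nlinarith [sq_nonneg (y 0), sq_nonneg (y 1)]
  have hcs : (y 0 * z 0 + y 1 * z 1) ^ 2 ≤ (y 2 * z 2 - 2) ^ 2 := by
    have h1 : (y 0 * z 0 + y 1 * z 1) ^ 2 ≤ (y 0 ^ 2 + y 1 ^ 2) * (z 0 ^ 2 + z 1 ^ 2) := by
      nlinarith [sq_nonneg (y 0 * z 1 - y 1 * z 0)]
    rw [hy1', hz1'] at h1
    nlinarith [mul_le_mul_of_nonneg_right h hz2.le, sq_nonneg (y 2)]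
  linarith [le_of_abs_le (abs_le_of_sq_le_sq hcs (by nlinarith))]

/-- In a compact quotient the nontrivial elements of `Γ` have a positive minimal displacement. -/
theorem exists_displacement {Γ : Subgroup SO21plus}
    (hfree : ∀ (A : Γ) (y : Hyp), A • y = y → A = 1) (hpd : ProperlyDiscontinuousSMul Γ Hyp)
    (hcpt : CompactSpace (QuotHyp Γ)) :
    ∃ ε > 0, ∀ A : Γ, A ≠ 1 → ∀ y : Hyp, mink y.1 (A • y : Hyp).1 ≤ -1 - ε := by
  have hq := isQuotientCoveringMap_proj hfree hpd
  -- By compactness, points of height less than `N` represent all of the quotient.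
  obtain ⟨N, hN⟩ := isCompact_univ.elim_directed_cover
    (fun n : ℕ => proj Γ '' {y : Hyp | y.1 2 < n})
    (fun n => hq.isOpenQuotientMap.isOpenMap _
      (isOpen_lt ((continuous_apply 2).comp continuous_subtype_val) continuous_const))
    (fun x _ => by
      obtain ⟨y, rfl⟩ := hq.surjective x
      obtain ⟨n, hn⟩ := exists_nat_gt (y.1 2)
      exact mem_iUnion.2 ⟨n, y, hn, rfl⟩)
    (Monotone.directed_le fun m n hmn => image_mono fun y (hy : y.1 2 < m) =>
      hy.trans_le (by exact_mod_cast hmn))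
  have hK := isCompact_sublevel N
  -- Only finitely many elements take a point of height at most `N` to height at most `4 * N`; for
  -- each of them other than `1` the pairing has a maximum below `-1`.
  have hfin := hpd.finite_disjoint_inter_image hK (isCompact_sublevel (4 * N))
  have hev : ∀ᶠ ε in 𝓝[>] (0 : ℝ), ∀ A ∈ {A : Γ | (((A • ·) : Hyp → Hyp) '' {y : Hyp | y.1 2 ≤ N} ∩
      {y : Hyp | y.1 2 ≤ 4 * N}).Nonempty}, A ≠ 1 →
        ∀ y : Hyp, y.1 2 ≤ N → mink y.1 (A • y : Hyp).1 ≤ -1 - ε := by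
    refine (Filter.eventually_all_finite hfin).2 fun A _ => ?_
    by_cases hA1 : A = 1
    · exact Filter.Eventually.of_forall fun _ h => absurd hA1 h
    rcases Set.eq_empty_or_nonempty {y : Hyp | y.1 2 ≤ N} with he | hne
    · exact Filter.Eventually.of_forall fun ε _ y hy =>
        absurd (show y ∈ {y : Hyp | y.1 2 ≤ N} from hy) (he ▸ notMem_empty y)
    have hcont : Continuous fun y : Hyp => mink y.1 (A • y : Hyp).1 :=
      continuous_mink.comp (continuous_subtype_val.prodMk
        (continuous_subtype_val.comp (continuous_const_smul A)))
    obtain ⟨y₀, -, hy₀⟩ := hK.exists_isMaxOn hne hcont.continuousOn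
    have hlt : mink y₀.1 (A • y₀ : Hyp).1 < -1 := mink_lt_neg_one_of_ne y₀.2 (A • y₀).2
      fun h => hA1 (hfree A y₀ (Subtype.ext h.symm))
    have hpos : 0 < -1 - mink y₀.1 (A • y₀ : Hyp).1 := by linarith
    filter_upwards [Ioo_mem_nhdsGT hpos] with ε hε _ y hy
    have : mink y.1 (A • y : Hyp).1 ≤ mink y₀.1 (A • y₀ : Hyp).1 := hy₀ hy
    linarith [hε.2]
  -- Also `ε < 1`, so that the bound `-2` covers the elements outside the finite set.
  obtain ⟨ε, hε, hε0, hε1⟩ := (hev.and (Ioo_mem_nhdsGT one_pos)).exists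
  have key : ∀ A : Γ, A ≠ 1 → ∀ y : Hyp, y.1 2 ≤ N → mink y.1 (A • y : Hyp).1 ≤ -1 - ε := by
    intro A hA y hy
    by_cases hAy : (A • y : Hyp).1 2 ≤ 4 * N
    · exact hε A ⟨A • y, ⟨y, hy, rfl⟩, hAy⟩ hA y hy
    · have := mink_le_neg_two y.2 (A • y).2 (by linarith [not_le.1 hAy])
      linarith
  refine ⟨ε, hε0, fun A hA y => ?_⟩
  obtain ⟨z, hz, hzy⟩ := hN (mem_univ (proj Γ y))
  -- An arbitrary point is moved to height below `N` at the price of conjugating `A`.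
  obtain ⟨B, hB, rfl⟩ := exists_smul_eq_of_proj_eq hzy.symm
  have h1 := key ((⟨B, hB⟩ : Γ)⁻¹ * A * ⟨B, hB⟩) (fun h => hA (by
    rw [mul_assoc, inv_mul_eq_one] at h
    simpa using h.symm)) z (show z.1 2 < N from hz).le
  have h2 : mink (B • z : Hyp).1 (A • (B • z) : Hyp).1 =
      mink z.1 (((⟨B, hB⟩ : Γ)⁻¹ * A * ⟨B, hB⟩) • z : Hyp).1 := by
    have e : (A • (B • z) : Hyp) = B • ((((⟨B, hB⟩ : Γ)⁻¹ * A * ⟨B, hB⟩) • z : Hyp)) := by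
      change (A • ((⟨B, hB⟩ : Γ) • z) : Hyp) =
        (⟨B, hB⟩ : Γ) • (((⟨B, hB⟩ : Γ)⁻¹ * A * ⟨B, hB⟩) • z)
      rw [smul_smul, smul_smul, mul_assoc, mul_inv_cancel_left]
    rw [e, coe_smul_hyp, coe_smul_hyp, mink_toCLM]
  rw [h2]
  exact h1

/-- With `θ` the angle between the two points, the pairing is `-1 - r² (1 - cos θ)`; the bound is
attained by antipodal points. -/
theorem mink_alphaVec_ge {r : ℝ} (hr : r ≠ 0) {f : V × V × V} (hf : f ∈ posFrames) (s t : ℝ) :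
    -1 - 2 * r ^ 2 ≤ mink (alphaVec r (2 * Real.pi * r) f s) (alphaVec r (2 * Real.pi * r) f t) := by
  have T := frameTable hf
  have hS := Real.sq_sqrt (show 0 ≤ 1 + r ^ 2 by positivity)
  have hc := Real.neg_one_le_cos (2 * Real.pi * s - 2 * Real.pi * t)
  rw [Real.cos_sub] at hc
  rw [alphaVec_two_pi hr, alphaVec_two_pi hr]
  simp only [mink_add_left, mink_add_right, mink_smul_left, mink_smul_right, T.m00, T.m01, T.m10,
    T.m11, T.m0w, T.m1w, T.mw0, T.mw1, T.mww]
  nlinarith [mul_le_mul_of_nonneg_left hc (sq_nonneg r)]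

theorem injOn_proj_alpha {Γ : Subgroup SO21plus} {ε r : ℝ} (hr : 0 < r) (hrε : 2 * r ^ 2 < ε)
    (hε : ∀ A : Γ, A ≠ 1 → ∀ y : Hyp, mink y.1 (A • y : Hyp).1 ≤ -1 - ε) (f : posFrames) :
    InjOn (proj Γ ∘ alpha r (2 * Real.pi * r) f) (Ico 0 1) := by
  intro s hs t ht h
  obtain ⟨A, hA, e⟩ := exists_smul_eq_of_proj_eq h
  by_cases hA1 : (⟨A, hA⟩ : Γ) = 1
  · have : A = 1 := congrArg Subtype.val hA1
    rw [this, one_smul] at e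
    exact injOn_alpha hr.ne' f hs ht e
  · have h1 := hε ⟨A, hA⟩ hA1 (alpha r (2 * Real.pi * r) f t)
    have h2 : ((⟨A, hA⟩ : Γ) • alpha r (2 * Real.pi * r) f t : Hyp) =
        alpha r (2 * Real.pi * r) f s := e.symm
    rw [h2] at h1
    have h3 := mink_alphaVec_ge hr.ne' f.2 t s
    simp only [alpha] at h1
    linarith

/-- Since `r² = 1 / (k₀² - 1)`, the claim is `2 / ε < k₀² - 1`, for which `2 + 2 / ε ≤ k₀` is more
than enough. -/
theorem IsRadius.two_mul_sq_lt {k₀ r ε : ℝ} (h : IsRadius k₀ r) (hε : 0 < ε)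
    (hk : 2 + 2 / ε ≤ k₀) : 2 * r ^ 2 < ε := by
  have h1 := h.sq_eq
  have h2 : 0 < 2 / ε := by positivity
  have h3 : 2 / ε < k₀ ^ 2 - 1 := by nlinarith
  rw [div_lt_iff₀ hε] at h3
  have h4 := mul_lt_mul_of_pos_right h3 (pow_pos h.1 2)
  nlinarith

end MagneticHyp

end

/-! ### The theorem -/

theorem lemma4 :
    -- the positive orthonormal frames form a three-dimensional manifold
    (MagneticHyp.posFrames.Nonempty ∧ MagneticHyp.IsSubmanifold3 MagneticHyp.posFrames) ∧
    -- the hyperbolic plane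
    (∀ k₀ : ℝ, 1 < k₀ →
      (∃! r : ℝ, MagneticHyp.IsRadius k₀ r) ∧
      ∀ r : ℝ, MagneticHyp.IsRadius k₀ r →
        (∀ γ : ℝ → MagneticHyp.Hyp,
          (MagneticHyp.IsSolHyp k₀ γ ∧ MagneticHyp.IsAlexHyp γ) ↔
            ∃ f : MagneticHyp.posFrames, γ = MagneticHyp.alpha r (2 * Real.pi * r) f) ∧
        (∀ f : MagneticHyp.posFrames,
          Set.InjOn (MagneticHyp.alpha r (2 * Real.pi * r) f) (Set.Ico 0 1)) ∧
        Function.Injective (MagneticHyp.alphaVec r (2 * Real.pi * r)) ∧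
        (∀ (n : ℕ) (f : MagneticHyp.posFrames), 1 ≤ n →
          MagneticHyp.IsSolHyp k₀ (MagneticHyp.alpha r (2 * Real.pi * n * r) f) ∧
          (MagneticHyp.IsAlexHyp (MagneticHyp.alpha r (2 * Real.pi * n * r) f) ↔ n = 1))) ∧
    -- compact quotients of the hyperbolic plane
    (∀ (Γ : Subgroup MagneticHyp.SO21plus),
      (∀ (A : Γ) (y : MagneticHyp.Hyp), A • y = y → A = 1) →
      ProperlyDiscontinuousSMul Γ MagneticHyp.Hyp →
      CompactSpace (MagneticHyp.QuotHyp Γ) →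
      ∃ C : ℝ, 1 < C ∧ ∀ k₀ : ℝ, C ≤ k₀ →
        (∃! r : ℝ, MagneticHyp.IsRadius k₀ r) ∧
        ∀ r : ℝ, MagneticHyp.IsRadius k₀ r →
          (∀ c : ℝ → MagneticHyp.QuotHyp Γ,
            (MagneticHyp.IsSolQuot Γ k₀ c ∧ MagneticHyp.IsAlexQuot Γ c) ↔
              ∃ f : MagneticHyp.posFrames,
                c = MagneticHyp.proj Γ ∘ MagneticHyp.alpha r (2 * Real.pi * r) f) ∧
          (∀ f : MagneticHyp.posFrames,
            Set.InjOn (MagneticHyp.proj Γ ∘ MagneticHyp.alpha r (2 * Real.pi * r) f)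
              (Set.Ico 0 1)) ∧
          (∀ f f' : MagneticHyp.posFrames,
            MagneticHyp.proj Γ ∘ MagneticHyp.alpha r (2 * Real.pi * r) f =
                MagneticHyp.proj Γ ∘ MagneticHyp.alpha r (2 * Real.pi * r) f' ↔
              ∃ A ∈ Γ, (f' : MagneticHyp.V × MagneticHyp.V × MagneticHyp.V) =
                (A.1.1.mulVec f.1.1, A.1.1.mulVec f.1.2.1, A.1.1.mulVec f.1.2.2)) ∧
          (∀ (n : ℕ) (f : MagneticHyp.posFrames), 1 ≤ n →
            MagneticHyp.IsSolQuot Γ k₀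
              (MagneticHyp.proj Γ ∘ MagneticHyp.alpha r (2 * Real.pi * n * r) f) ∧
            (MagneticHyp.IsAlexQuot Γ
              (MagneticHyp.proj Γ ∘ MagneticHyp.alpha r (2 * Real.pi * n * r) f) ↔ n = 1))) := by
  refine ⟨⟨⟨_, MagneticHyp.boostFrame_mem 0 0⟩, MagneticHyp.isSubmanifold3_posFrames⟩,
    fun k₀ hk => ⟨MagneticHyp.existsUnique_isRadius hk, fun r hr =>
      ⟨MagneticHyp.isSolHyp_and_isAlexHyp_iff hr, MagneticHyp.injOn_alpha hr.1.ne',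
        MagneticHyp.injective_alphaVec hr.1.ne', fun n f hn =>
          ⟨MagneticHyp.isSolHyp_alpha hr f hn, MagneticHyp.isAlexHyp_alpha_iff hr.1 hn f⟩⟩⟩,
    fun Γ hfree hpd hcpt => ?_⟩
  have hq := MagneticHyp.isQuotientCoveringMap_proj hfree hpd
  obtain ⟨ε, hε, hdisp⟩ := MagneticHyp.exists_displacement hfree hpd hcpt
  -- The summand `2` gives `1 < k₀`, hence a radius; `2 / ε` keeps the circles below the minimal
  -- displacement.
  have hC : 1 < 2 + 2 / ε := by
    have : 0 < 2 / ε := by positivity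
    linarith
  exact ⟨2 + 2 / ε, hC, fun k₀ hk => ⟨MagneticHyp.existsUnique_isRadius (hC.trans_le hk),
    fun r hr => ⟨MagneticHyp.isSolQuot_and_isAlexQuot_iff hq hr,
      MagneticHyp.injOn_proj_alpha hr.1 (hr.two_mul_sq_lt hε hk) hdisp,
      MagneticHyp.proj_alpha_eq_iff hq hr.1, fun n f hn =>
        ⟨(MagneticHyp.isSolHyp_alpha hr f hn).isSolQuot Γ,
          MagneticHyp.isAlexQuot_alpha_iff hq hr.1 hn f⟩⟩⟩⟩
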